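/- **Theorem 3.** Let $K>0$, let $r_N<r_S$, and let $f:[r_N,r_S]\to\mathbb R$ be smooth with $f>0$ on $(r_N,r_S)$, $f(r_N)=f(r_S)=0$ and $f''=-Kf$ (so that $dr^2+f(r)^2d\theta^2$ is the metric of a spherical surface of revolution of constant curvature $K$). Let $\beta\in\mathbb R$ satisfy $-ff''+(f')^2=\beta^2$, let $\Theta=-f'/(\beta^2 f)$ (an antiderivative of $1/f^2$ on $(r_N,r_S)$), and let $\gamma>0$ and $h\in\mathbb R$. On the energy manifold $$\mathbf M(h)=\Big\{(r,v,\theta,u):\ r\in[r_N,r_S],\ \theta\in\mathbb R/2\pi\mathbb Z,\ \operatorname{sgn}(\Theta(r))\,\tfrac{u^2+v^2}{2}+\gamma=\tfrac{h}{\Theta(r)}\Big\}$$ (points with $\Theta(r)=0$ are excluded; at $r=r_N$ one takes $\operatorname{sgn}\Theta=-1$ and $1/\Theta=0$, and no point has $r=r_S$) consider the flow $\psi$, which need not be defined for all times, of the time-rescaled Kepler system $$\dot r=vf(r),\quad \dot v=u^2f'(r)-\frac{v^2}{2f(r)\Theta(r)}-\frac{\gamma}{f(r)|\Theta(r)|},\quad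 \dot\theta=u,\quad \dot u=-uv\Big(f'(r)+\frac{1}{2f(r)\Theta(r)}\Big),$$ extended continuously to $r=r_N$ by $1/(f\Theta)=-\beta^2/f'$. Let $\mathbf N=\{x\in\mathbf M(h): r=r_N\}=\{r=r_N,\ u^2+v^2=2\gamma\}$ be the collision manifold. Definitions. A compact invariant set is *isolated* if it has an isolating neighborhood, i.e. an open set that contains it and in which every orbit that stays in the open set starts in the invariant set. For a compact $\mathbf B\subset\mathbf M(h)$ with non-empty interior whose boundary $\mathbf b=\partial\mathbf B$ is a smooth hypersurface of $\mathbf M(h)$, let $\mathbf b^+$ (resp. $\mathbf b^-$) be the set of points of $\mathbf b$ whose orbit is outside $\mathbf B$ for all sufficiently small negative (resp. positive) times, and let $\mathbf t$ be the set of points of $\mathbf b$ at which the vector field is tangent to $\mathbf b$. $\mathbf B$ is an *isolating block* if $\mathbf t=\mathbf b^+\cap\mathbf b^-$ and $\mathbf t$ is a smooth submanifold of $\mathbf b$ of codimension $1$; it *isolates* $\mathbf N$ if its interior is an isolating neighborhood for $\mathbf N$. Let $\mathbf a^+$ be the set of points of $\mathbf b^+$ whose forward orbit stays in $\mathbf B$,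 and for $x\in\mathbf b^+\setminus\mathbf a^+$ let $\Psi(x)=\psi(x,T(x))$ with $T(x)=\inf\{t>0:\psi(x,t)\notin\mathbf B\}$. $\mathbf B$ is *trivializable* if $\Psi$ extends uniquely to a diffeomorphism from $\mathbf b^+$ to $\mathbf b^-$, and an isolated invariant set is *trivializable* if some isolating block that isolates it is trivializable. If $\mathbf N$ is a trivializable isolated invariant set for this flow, then $|\beta|=2/m$ for some positive integer $m$. -/

import Mathlib

open scoped ContDiff Topology

/-! ## Isolating blocks of a (possibly incomplete) smooth flow

The phase space is a subset `M` of a real normed space `E` with its induced topology and smooth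
structure, and the flow is the one of a vector field `F` which is tangent to `M`. -/

namespace Conley

section
variable {E : Type*} [NormedAddCommGroup E] [NormedSpace ℝ E]

/-- `FlowsTo M F x t y` says that `ψ(x, t)` is defined and equal to `y`, where `ψ` is the
flow of `ẋ = F(x)` on `M`: a solution of the equation on an open interval that contains `0` and `t`
stays in `M` and goes from `x` at time `0` to `y` at time `t`. -/
def FlowsTo (M : Set E) (F : E → E) (x : M) (t : ℝ) (y : M) : Prop :=
  ∃ (a b : ℝ) (c : ℝ → E), (0 : ℝ) ∈ Set.Ioo a b ∧ t ∈ Set.Ioo a b ∧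
    (∀ s ∈ Set.Ioo a b, c s ∈ M ∧ HasDerivAt c (F (c s)) s) ∧ c 0 = x ∧ c t = y

/-- `G` defines `S` near `p` as a smooth submanifold of codimension `k`. -/
def IsLocalDefiningMap (S : Set E) (k : ℕ) (p : E) (G : E → (Fin k → ℝ)) : Prop :=
  ∃ O : Set E, IsOpen O ∧ p ∈ O ∧ ContDiffOn ℝ ∞ G O ∧
    Function.Surjective (fderiv ℝ G p) ∧ S ∩ O = {x ∈ O | G x = 0}

/-- `S` is an embedded smooth submanifold, without boundary, of codimension `k` in `E`. -/
def IsSmoothSubmanifold (S : Set E) (k : ℕ) : Prop :=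
  ∀ p ∈ S, ∃ G : E → (Fin k → ℝ), IsLocalDefiningMap S k p G

/-- The vector `w` is tangent to the submanifold `S` of codimension `k` at its point `p`,
i.e. it lies in the kernel of the derivative of a local defining map. -/
def IsTangentTo (S : Set E) (k : ℕ) (p w : E) : Prop :=
  ∃ G : E → (Fin k → ℝ), IsLocalDefiningMap S k p G ∧ fderiv ℝ G p w = 0

/-- A map between subsets of `M` is smooth if it extends, locally at each point, to a
smooth map on an open subset of the ambient space. -/
def IsSmoothMap {M : Set E} {A A' : Set M} (φ : A → A') : Prop :=
  ∀ p : A, ∃ O : Set E, IsOpen O ∧ ((p : M) : E) ∈ O ∧ ∃ g : E → E, ContDiffOn ℝ ∞ g O ∧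
    ∀ q : A, ((q : M) : E) ∈ O → g ((q : M) : E) = ((φ q : M) : E)

variable (M : Set E) (F : E → E)

/-- `ψ(N, ℝ) = N`. -/
def IsInvariant (N : Set M) : Prop :=
  ∀ x ∈ N, ∀ t : ℝ, (∃ y, FlowsTo M F x t y) ∧ ∀ y, FlowsTo M F x t y → y ∈ N

/-- `U` is an isolating neighbourhood for `N`: it is open in `M`, contains `N`, and every orbit that
is contained in `U` starts in `N`. -/
def IsIsolatingNeighborhood (U N : Set M) : Prop :=
  IsOpen U ∧ N ⊆ U ∧ ∀ x : M, (∀ (t : ℝ) (y : M), FlowsTo M F x t y → y ∈ U) → x ∈ N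

/-- Isolated (compact) invariant sets. -/
def IsIsolatedInvariantSet (N : Set M) : Prop :=
  IsCompact N ∧ IsInvariant M F N ∧ ∃ U : Set M, IsIsolatingNeighborhood M F U N

/-- The set `b⁺` of ingress points of `B`; `frontier B` is the boundary of `B` in `M`. -/
def ingress (B : Set M) : Set M :=
  {x | x ∈ frontier B ∧ ∃ ε > 0, ∀ t ∈ Set.Ioo (-ε) (0 : ℝ), ∀ y, FlowsTo M F x t y → y ∉ B}

/-- The set `b⁻` of egress points of `B`. -/
def egress (B : Set M) : Set M :=
  {x | x ∈ frontier B ∧ ∃ ε > 0, ∀ t ∈ Set.Ioo (0 : ℝ) ε, ∀ y, FlowsTo M F x t y → y ∉ B}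

/-- The set `t` of tangency points of `b = ∂B`, where `b` has codimension `k` in `E`. -/
def tangency (k : ℕ) (B : Set M) : Set M :=
  {x | x ∈ frontier B ∧ IsTangentTo (Subtype.val '' frontier B) k (x : E) (F x)}

/-- The points `a⁺` of `b⁺` whose forward orbit stays in `B`. -/
def forwardAsymptotic (B : Set M) : Set M :=
  {x | x ∈ ingress M F B ∧ ∀ t ≥ (0 : ℝ), ∀ y, FlowsTo M F x t y → y ∈ B}

/-- `B` is an isolating block in `M`, where `M` has codimension `k` in `E`: thus `b = ∂B` has
codimension `k + 1` in `E`, i.e. codimension one in `M`, and `t` has codimension one in `b`. -/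
structure IsIsolatingBlock (k : ℕ) (B : Set M) : Prop where
  isCompact : IsCompact B
  interior_nonempty : (interior B).Nonempty
  boundary_smooth : IsSmoothSubmanifold (Subtype.val '' frontier B : Set E) (k + 1)
  tangency_eq : tangency M F (k + 1) B = ingress M F B ∩ egress M F B
  tangency_smooth : IsSmoothSubmanifold (Subtype.val '' tangency M F (k + 1) B : Set E) (k + 2)

/-- `y = Ψ(x) = ψ(x, T(x))` with `T(x) = inf {t > 0 | ψ(x, t) ∉ B}`, for the map `Ψ` across the
block `B`. -/
def MapsAcross (B : Set M) (x y : M) : Prop :=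
  ∃ T : ℝ, {t : ℝ | 0 < t ∧ ∃ z, FlowsTo M F x t z ∧ z ∉ B}.Nonempty ∧
    IsGLB {t : ℝ | 0 < t ∧ ∃ z, FlowsTo M F x t z ∧ z ∉ B} T ∧ FlowsTo M F x T y

/-- `B` is trivializable: the map `Ψ` across `B`, which is defined on `b⁺ - a⁺`, extends uniquely to
a diffeomorphism from `b⁺` to `b⁻`. -/
def IsTrivializableBlock (B : Set M) : Prop :=
  ∃! Φ : ingress M F B ≃ egress M F B, IsSmoothMap Φ ∧ IsSmoothMap Φ.symm ∧
    ∀ x : ingress M F B, (x : M) ∉ forwardAsymptotic M F B → MapsAcross M F B x (Φ x)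

/-- `N` is a trivializable isolated invariant set: an isolated invariant set which is isolated by
(the interior of) a trivializable isolating block. -/
def IsTrivializableIsolatedInvariantSet (k : ℕ) (N : Set M) : Prop :=
  IsIsolatedInvariantSet M F N ∧ ∃ B : Set M, IsIsolatingBlock M F k B ∧
    IsIsolatingNeighborhood M F (interior B) N ∧ IsTrivializableBlock M F B

end

end Conley

/-! ## The generalized Kepler problem -/

namespace Kepler

/-- `f` is the radius function on `[rN, rS]` of a spherical surface of revolution with metric
`dr² + f(r)² dθ²` of constant positive Gaussian curvature `K = -f''/f`. -/
structure IsSphericalRadius (f : ℝ → ℝ) (rN rS K : ℝ) : Prop where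
  lt : rN < rS
  smooth : ContDiff ℝ ∞ f
  pos : ∀ r ∈ Set.Ioo rN rS, 0 < f r
  north : f rN = 0
  south : f rS = 0
  curvature_pos : 0 < K
  curvature : ∀ r ∈ Set.Icc rN rS, deriv (deriv f) r = -K * f r

section
variable (f : ℝ → ℝ) (β : ℝ)

/-- The antiderivative `Θ` of `1/f²` on `(rN, rS)` with `f'/f = -β² Θ`. -/
noncomputable def Theta (r : ℝ) : ℝ := -deriv f r / (β ^ 2 * f r)

/-- `1/Θ`, continued to the poles (by the value `0`). -/
noncomputable def invTheta (r : ℝ) : ℝ := -(β ^ 2 * f r) / deriv f r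

/-- `sgn Θ`, continued to the poles. -/
noncomputable def sgnTheta (r : ℝ) : ℝ := -Real.sign (deriv f r)

/-- `1/(f Θ)`, continued to the poles. -/
noncomputable def invFTheta (r : ℝ) : ℝ := -β ^ 2 / deriv f r

theorem Theta_mul (hβ : β ≠ 0) (r : ℝ) : deriv f r / f r = -β ^ 2 * Theta f β r := by
  unfold Theta
  by_cases hr : f r = 0
  · simp [hr]
  · field_simp

theorem hasDerivAt_Theta (hf : ContDiff ℝ ∞ f) (hβ : β ≠ 0) {r : ℝ} (hr : f r ≠ 0)
    (h : -f r * deriv (deriv f) r + deriv f r ^ 2 = β ^ 2) :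
    HasDerivAt (Theta f β) (1 / f r ^ 2) r := by
  have h1 : HasDerivAt f (deriv f r) r :=
    (hf.differentiable (by simp)).differentiableAt.hasDerivAt
  have h2 : HasDerivAt (deriv f) (deriv (deriv f) r) r :=
    ((contDiff_infty_iff_deriv.1 hf).2.differentiable (by simp)).differentiableAt.hasDerivAt
  have h3 := h2.neg.div (h1.const_mul (β ^ 2)) (mul_ne_zero (pow_ne_zero 2 hβ) hr)
  refine h3.congr_deriv ?_
  field_simp
  simp only [Pi.neg_apply]
  linear_combination h

theorem invTheta_eq (r : ℝ) : invTheta f β r = 1 / Theta f β r := by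
  unfold invTheta Theta
  rw [one_div, inv_div, div_neg, neg_div]

theorem sgnTheta_eq (hβ : β ≠ 0) {r : ℝ} (hr : 0 < f r) :
    sgnTheta f r = Real.sign (Theta f β r) := by
  have hp : 0 < β ^ 2 * f r := by positivity
  unfold sgnTheta Theta
  rcases lt_trichotomy (deriv f r) 0 with h | h | h
  · rw [Real.sign_of_neg h, Real.sign_of_pos (div_pos (neg_pos.2 h) hp)]; norm_num
  · simp [h]
  · rw [Real.sign_of_pos h, Real.sign_of_neg (div_neg_of_neg_of_pos (neg_neg_of_pos h) hp)]

theorem invFTheta_eq {r : ℝ} (hr : f r ≠ 0) :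
    invFTheta f β r = 1 / (f r * Theta f β r) := by
  unfold invFTheta Theta
  have : f r * (-deriv f r / (β ^ 2 * f r)) = -deriv f r / β ^ 2 := by field_simp
  rw [this, one_div, inv_div, div_neg, neg_div]

theorem abs_invFTheta_eq {r : ℝ} (hr : 0 < f r) :
    |invFTheta f β r| = 1 / (f r * |Theta f β r|) := by
  rw [invFTheta_eq f β hr.ne', abs_div, abs_one, abs_mul, abs_of_pos hr]

/-- Phase points `(r, v, z, u)`, where `z = exp(iθ)` records the angle `θ` modulo `2π`. -/
abbrev Phase : Type := ℝ × ℝ × ℂ × ℝ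

/-- The energy manifold `M(h)`: `rN ≤ r ≤ rS`, `Θ ≠ 0` and
`sgn(Θ) (u² + v²)/2 + γ = h/Θ`. Here `z` lies on the unit circle, and `f' = 0` where `Θ = 0`. -/
def energyManifold (rN rS γ h : ℝ) : Set Phase :=
  {x | x.1 ∈ Set.Icc rN rS ∧ ‖x.2.2.1‖ = 1 ∧ deriv f x.1 ≠ 0 ∧
    sgnTheta f x.1 * ((x.2.2.2 ^ 2 + x.2.1 ^ 2) / 2) + γ = h * invTheta f β x.1}

/-- The time-rescaled system
`ṙ = v f`, `v̇ = u² f' - v²/(2fΘ) - γ/(f|Θ|)`, `θ̇ = u`, `u̇ = -uv (f' + 1/(2fΘ))`;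
in terms of `z = exp(iθ)` the third equation is `ż = i u z`. -/
noncomputable def field (γ : ℝ) (x : Phase) : Phase :=
  (x.2.1 * f x.1,
   x.2.2.2 ^ 2 * deriv f x.1 - x.2.1 ^ 2 / 2 * invFTheta f β x.1 - γ * |invFTheta f β x.1|,
   Complex.I * (x.2.2.2 : ℂ) * x.2.2.1,
   -(x.2.2.2 * x.2.1) * (deriv f x.1 + invFTheta f β x.1 / 2))

/-- The collision manifold `N`: the points of `M(h)` with `r = rN`. -/
def collisionManifold (rN rS γ h : ℝ) : Set (energyManifold f β rN rS γ h) :=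
  {x | (x : Phase).1 = rN}

end

theorem IsSphericalRadius.beta_ne_zero {f : ℝ → ℝ} {rN rS K β : ℝ}
    (hf : IsSphericalRadius f rN rS K)
    (hβ : ∀ r ∈ Set.Icc rN rS, -f r * deriv (deriv f) r + deriv f r ^ 2 = β ^ 2) : β ≠ 0 := by
  rintro rfl
  have hm : (rN + rS) / 2 ∈ Set.Ioo rN rS := ⟨by linarith [hf.lt], by linarith [hf.lt]⟩
  have h1 := hβ _ (Set.Ioo_subset_Icc_self hm)
  rw [hf.curvature _ (Set.Ioo_subset_Icc_self hm)] at h1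
  have h2 := hf.pos _ hm
  have h3 : 0 < K * f ((rN + rS) / 2) ^ 2 := mul_pos hf.curvature_pos (by positivity)
  nlinarith [sq_nonneg (deriv f ((rN + rS) / 2))]

theorem IsSphericalRadius.deriv_north {f : ℝ → ℝ} {rN rS K β : ℝ}
    (hf : IsSphericalRadius f rN rS K)
    (hβ : ∀ r ∈ Set.Icc rN rS, -f r * deriv (deriv f) r + deriv f r ^ 2 = β ^ 2) :
    deriv f rN = |β| := by
  have h1 := hβ rN ⟨le_rfl, hf.lt.le⟩
  have h0 : 0 ≤ deriv f rN := by
    have hd : HasDerivAt f (deriv f rN) rN :=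
      (hf.smooth.differentiable (by simp)).differentiableAt.hasDerivAt
    have ht := (hasDerivAt_iff_tendsto_slope.1 hd).mono_left
      (nhdsWithin_mono rN (fun y (hy : y ∈ Set.Ioi rN) => ne_of_gt hy))
    refine ge_of_tendsto ht ?_
    filter_upwards [Ioo_mem_nhdsGT hf.lt] with y hy
    rw [slope_def_field, hf.north, sub_zero]
    exact div_nonneg (hf.pos y hy).le (sub_nonneg.2 hy.1.le)
  rw [hf.north] at h1
  rw [← abs_of_nonneg h0]
  exact (sq_eq_sq_iff_abs_eq_abs _ _).1 (by linarith)

/-- The collision manifold is the torus `r = rN`, `u² + v² = 2γ`. -/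
theorem mem_energyManifold_north {f : ℝ → ℝ} {rN rS K β γ h : ℝ}
    (hf : IsSphericalRadius f rN rS K)
    (hβ : ∀ r ∈ Set.Icc rN rS, -f r * deriv (deriv f) r + deriv f r ^ 2 = β ^ 2)
    (v u : ℝ) (z : ℂ) :
    ((rN, v, z, u) : Phase) ∈ energyManifold f β rN rS γ h ↔
      ‖z‖ = 1 ∧ u ^ 2 + v ^ 2 = 2 * γ := by
  have hd : 0 < deriv f rN := by
    rw [hf.deriv_north hβ]; exact abs_pos.2 (hf.beta_ne_zero hβ)
  simp only [energyManifold, Set.mem_ofPred_eq, Set.left_mem_Icc, hf.lt.le, true_and, sgnTheta,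
    invTheta, hf.north, Real.sign_of_pos hd, ne_eq, hd.ne', not_false_eq_true]
  refine and_congr_right fun _ => ?_
  constructor <;> intro h' <;> ring_nf at h' ⊢ <;> linarith

end Kepler

/-!
Write `w = -Θ` and let `J = u f √w` be the angular momentum, a conserved quantity of the rescaled
system. On the northern hemisphere the system is a Kepler problem, and for `J ≠ 0` its orbits are
explicit up to the parametrization by time: there is a phase `φ` with `θ = φ / |β|` (up to a constant
and the sign of `J`), `φ̇ = |β| |u|` and `β² J² w = γ + R cos φ`, where
`R² = γ² + 2hβ²J² - KJ⁴`. See `orbit`, `orbit_mem` and `hasDerivAt_orbit`. Fix `r₁` close to `rN`. As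
`J → 0` we have `R → γ`, and the phases at which the orbit crosses `r = r₁` tend to `±π`. So an orbit
that comes in at the angle `0` with a small angular momentum passes near the collision manifold and
goes out at an angle near `2π/|β|` if `J > 0` and near `-2π/|β|` if `J < 0` (`exists_passage`).

Let `B` be a trivializable block that isolates the collision manifold, and choose `r₁` such that all
points with `r ≤ r₁` lie in the interior of `B` (`exists_collar`). The radial orbit `u = 0` that comes
in through `r = r₁` at the angle `0` ends on the collision manifold. By isolation it cannot have been
in the interior of `B` forever, so it has a last entry point `p ∈ b⁺`. The radial orbits that go out at
the angles `±2π/|β|` leave `B` after a finite time, again by isolation. Orbits with small `J`, close to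
the incoming radial orbit, enter `B` at points of `b⁺` close to `p` (`exists_entry_near`), pass by,
and follow one of the outgoing radial orbits until they leave `B`. Since the angle is constant on radial
orbits, a continuous extension of the map across `B` gives `p` an image whose angle is both `2π/|β|`
and `-2π/|β|` modulo `2π` (`exists_extension_eq`). Hence `4π/|β|` is a multiple of `2π`.

That an orbit which enters the interior of `B` through a boundary point comes from outside `B`, and that
one which leaves the interior really leaves `B`, follows from the tangency condition for blocks
(`IsIsolatingBlock.mem_ingress`). This step uses no normal form for the boundary, only that a transverse
defining function is strictly monotone along nearby orbits. The continuous dependence of orbits on their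
initial points comes from the Picard–Lindelöf theorem and Grönwall's inequality for a cut-off field,
together with the invariance of the energy manifold.
-/

/-! ### Orbits, uniqueness and continuous dependence -/

namespace Conley

section Curves
variable {E : Type*} [NormedAddCommGroup E] [NormedSpace ℝ E]

/-- `c` solves `ċ = F(c)` inside `M` on the open interval `(a, b)`. -/
def IsSolutionOn (M : Set E) (F : E → E) (a b : ℝ) (c : ℝ → E) : Prop :=
  ∀ s ∈ Set.Ioo a b, c s ∈ M ∧ HasDerivAt c (F (c s)) s

variable {M : Set E} {F : E → E} {a b : ℝ} {c : ℝ → E}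

theorem IsSolutionOn.mono (h : IsSolutionOn M F a b c) {a' b' : ℝ} (ha : a ≤ a') (hb : b' ≤ b) :
    IsSolutionOn M F a' b' c :=
  fun s hs => h s ⟨ha.trans_lt hs.1, hs.2.trans_le hb⟩

theorem IsSolutionOn.continuousOn (h : IsSolutionOn M F a b c) :
    ContinuousOn c (Set.Ioo a b) :=
  fun s hs => (h s hs).2.continuousAt.continuousWithinAt

theorem IsSolutionOn.shift (h : IsSolutionOn M F a b c) (d : ℝ) :
    IsSolutionOn M F (a - d) (b - d) (fun s => c (s + d)) := by
  intro s hs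
  have hs' : s + d ∈ Set.Ioo a b := ⟨by linarith [hs.1], by linarith [hs.2]⟩
  exact ⟨(h _ hs').1, (h _ hs').2.comp_add_const s d⟩

theorem IsSolutionOn.reverse (h : IsSolutionOn M F a b c) :
    IsSolutionOn M (-F) (-b) (-a) (fun s => c (-s)) := by
  intro s hs
  have hs' : -s ∈ Set.Ioo a b := ⟨by linarith [hs.2], by linarith [hs.1]⟩
  refine ⟨(h _ hs').1, ?_⟩
  have := (h _ hs').2.scomp s (hasDerivAt_neg s)
  simpa using! this

theorem IsSolutionOn.flowsTo (h : IsSolutionOn M F a b c) {s t : ℝ} (hs : s ∈ Set.Ioo a b)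
    (ht : t ∈ Set.Ioo a b) :
    FlowsTo M F ⟨c s, (h s hs).1⟩ (t - s) ⟨c t, (h t ht).1⟩ :=
  ⟨a - s, b - s, fun x => c (x + s), ⟨by linarith [hs.1], by linarith [hs.2]⟩,
    ⟨by linarith [ht.1], by linarith [ht.2]⟩, h.shift s, by simp, by simp⟩

theorem FlowsTo.reverse {x y : M} {t : ℝ} (h : FlowsTo M F x t y) : FlowsTo M (-F) x (-t) y := by
  obtain ⟨a, b, c, h0, ht, hc, h1, h2⟩ := h
  exact ⟨-b, -a, fun s => c (-s), ⟨by linarith [h0.2], by linarith [h0.1]⟩,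
    ⟨by linarith [ht.2], by linarith [ht.1]⟩, IsSolutionOn.reverse hc, by simpa using h1,
    by simpa using h2⟩

theorem flowsTo_neg {x y : M} {t : ℝ} : FlowsTo M (-F) x t y ↔ FlowsTo M F x (-t) y :=
  ⟨fun h => by simpa using h.reverse, fun h => by simpa using h.reverse⟩

theorem FlowsTo.symm {x y : M} {t : ℝ} (h : FlowsTo M F x t y) : FlowsTo M F y (-t) x := by
  obtain ⟨a, b, c, h0, ht, hc, h1, h2⟩ := h
  have := IsSolutionOn.flowsTo hc ht h0
  simpa only [h1, h2, zero_sub] using this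

end Curves

section Lipschitz
variable {E : Type*} [NormedAddCommGroup E] [NormedSpace ℝ E]

/-- A bounded, globally Lipschitz field has solutions on every time interval. -/
theorem exists_solution_of_lipschitz [CompleteSpace E] {G : E → E} {K : NNReal} {L : NNReal}
    (hG : LipschitzWith K G) (hb : ∀ x, ‖G x‖ ≤ L) (x : E) {T : ℝ} (hT : 0 < T) :
    ∃ c : ℝ → E, c 0 = x ∧ ∀ t ∈ Set.Ioo (-T) T, HasDerivAt c (G (c t)) t := by
  have hpl : IsPicardLindelof (fun _ => G) (tmin := -T) (tmax := T)
      ⟨0, by linarith, hT.le⟩ x (L * T.toNNReal) 0 L K :=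
    IsPicardLindelof.of_time_independent (fun y _ => hb y) hG.lipschitzOnWith (by simp [hT.le])
  obtain ⟨c, h0, hc⟩ := hpl.exists_eq_forall_mem_Icc_hasDerivWithinAt₀
  exact ⟨c, h0, fun t ht =>
    (hc t (Set.Ioo_subset_Icc_self ht)).hasDerivAt (Icc_mem_nhds ht.1 ht.2)⟩

/-- A field which is smooth near a compact set agrees, near that set, with a bounded and globally
Lipschitz field. -/
theorem exists_lipschitz_eqOn [FiniteDimensional ℝ E] {U C : Set E} (hU : IsOpen U)
    {F : E → E} (hF : ContDiffOn ℝ ∞ F U) (hC : IsCompact C) (hCU : C ⊆ U) :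
    ∃ (G : E → E) (K L : NNReal) (V : Set E), LipschitzWith K G ∧ (∀ x, ‖G x‖ ≤ L) ∧ IsOpen V ∧
      C ⊆ V ∧ V ⊆ U ∧ Set.EqOn G F V := by
  have : ProperSpace E := FiniteDimensional.proper ℝ E
  obtain ⟨D, hD, hCD, hDU⟩ := exists_compact_between hC hU hCU
  obtain ⟨χ, h0, h1, -⟩ := exists_contMDiffMap_zero_one_nhds_of_isClosed (n := ⊤)
    (modelWithCornersSelf ℝ E) (s := (interior D)ᶜ) (t := C) isOpen_interior.isClosed_compl
    hC.isClosed (Set.disjoint_left.2 fun x hx hx' => hx (hCD hx'))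
  have hχ : ContDiff ℝ ∞ χ := χ.contMDiff.contDiff
  have hzero : ∀ x ∉ interior D, χ x = 0 := fun x hx =>
    (Filter.eventually_of_mem (mem_nhdsSet_iff_forall.1 h0 x hx) fun _ => id).self_of_nhds
  have hsmooth : ContDiff ℝ ∞ (fun x => χ x • F x) := by
    rw [contDiff_iff_contDiffAt]
    intro x
    by_cases hx : x ∈ U
    · exact hχ.contDiffAt.smul (hF.contDiffAt (hU.mem_nhds hx))
    · have hx' : x ∈ (interior D)ᶜ := fun h => hx (hDU (interior_subset h))
      refine (contDiffAt_const (c := (0 : E))).congr_of_eventuallyEq ?_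
      filter_upwards [mem_nhdsSet_iff_forall.1 h0 x hx'] with y hy
      have hy : χ y = 0 := hy
      simp [hy]
  have hsupp : HasCompactSupport (fun x => χ x • F x) :=
    HasCompactSupport.intro hD fun x hx => by
      simp [hzero x fun h => hx (interior_subset h)]
  obtain ⟨K, hK⟩ := ContDiff.lipschitzWith_of_hasCompactSupport hsupp hsmooth (by simp)
  obtain ⟨L, hL⟩ := hsupp.exists_bound_of_continuous hsmooth.continuous
  obtain ⟨V, hV, hCV, hV1⟩ := mem_nhdsSet_iff_exists.1 h1
  refine ⟨_, K, ⟨max L 0, le_max_right _ _⟩, V ∩ U, hK, fun x => (hL x).trans (le_max_left _ _),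
    hV.inter hU, Set.subset_inter hCV hCU, Set.inter_subset_right, fun x hx => ?_⟩
  have : χ x = 1 := hV1 hx.1
  simp [this]

variable [FiniteDimensional ℝ E] {U : Set E} {F : E → E} {a b : ℝ}

/-- Two solutions of a smooth equation which agree at one time agree. -/
theorem IsSolutionOn.eqOn (hU : IsOpen U) (hF : ContDiffOn ℝ ∞ F U) {c₁ c₂ : ℝ → E}
    (h₁ : IsSolutionOn U F a b c₁) (h₂ : IsSolutionOn U F a b c₂) {s₀ : ℝ}
    (hs₀ : s₀ ∈ Set.Ioo a b) (h : c₁ s₀ = c₂ s₀) : Set.EqOn c₁ c₂ (Set.Ioo a b) := by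
  intro t ht
  have hm := lt_min hs₀.1 ht.1
  have hM := max_lt hs₀.2 ht.2
  obtain ⟨a', ha', ha''⟩ := exists_between hm
  obtain ⟨b', hb', hb''⟩ := exists_between hM
  have hsub : Set.Icc a' b' ⊆ Set.Ioo a b := Set.Icc_subset_Ioo ha' hb''
  have hc₁ := h₁.continuousOn.mono hsub
  have hc₂ := h₂.continuousOn.mono hsub
  obtain ⟨G, K, L, V, hG, -, -, hCV, -, hV⟩ := exists_lipschitz_eqOn hU hF
    ((isCompact_Icc.image_of_continuousOn hc₁).union (isCompact_Icc.image_of_continuousOn hc₂))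
    (Set.union_subset (Set.image_subset_iff.2 fun s hs => (h₁ s (hsub hs)).1)
      (Set.image_subset_iff.2 fun s hs => (h₂ s (hsub hs)).1))
  refine ODE_solution_unique_of_mem_Icc (v := fun _ => G) (s := fun _ => Set.univ) (t₀ := s₀)
    (fun _ _ => hG.lipschitzOnWith) ⟨ha''.trans_le (min_le_left _ _),
    (le_max_left _ _).trans_lt hb'⟩ hc₁ (fun s hs => ?_) (fun _ _ => trivial) hc₂ (fun s hs => ?_)
    (fun _ _ => trivial) h ⟨(ha''.trans_le (min_le_right _ _)).le,
    ((le_max_right _ _).trans_lt hb').le⟩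
  · have hs' := Set.Ioo_subset_Icc_self hs
    rw [hV (hCV (Or.inl ⟨s, hs', rfl⟩))]
    exact (h₁ s (hsub hs')).2
  · have hs' := Set.Ioo_subset_Icc_self hs
    rw [hV (hCV (Or.inr ⟨s, hs', rfl⟩))]
    exact (h₂ s (hsub hs')).2

/-- Continuous dependence on the initial point, on a compact interval of time. -/
theorem IsSolutionOn.exists_near (hU : IsOpen U) (hF : ContDiffOn ℝ ∞ F U) {c : ℝ → E}
    (hc : IsSolutionOn U F a b c) {a' b' : ℝ} (ha' : a' ∈ Set.Ioo a 0) (hb' : b' ∈ Set.Ioo 0 b)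
    {ε : ℝ} (hε : 0 < ε) :
    ∃ δ > 0, ∀ y, dist y (c 0) < δ → ∃ c', c' 0 = y ∧ IsSolutionOn U F a' b' c' ∧
      ∀ s ∈ Set.Ioo a' b', dist (c' s) (c s) < ε := by
  have hsub : Set.Icc a' b' ⊆ Set.Ioo a b := Set.Icc_subset_Ioo ha'.1 hb'.2
  have hcc := hc.continuousOn.mono hsub
  obtain ⟨G, K, L, V, hG, hGb, hVo, hCV, hVU, hV⟩ := exists_lipschitz_eqOn hU hF
    (isCompact_Icc.image_of_continuousOn hcc)
    (Set.image_subset_iff.2 fun s hs => (hc s (hsub hs)).1)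
  obtain ⟨η, hη, hηV⟩ :=
    (isCompact_Icc.image_of_continuousOn hcc).exists_thickening_subset_open hVo hCV
  set T : ℝ := b' - a' with hTdef
  have hT : 0 < T := by linarith [ha'.2, hb'.1]
  refine ⟨min ε η * Real.exp (-(K * T)), by positivity, fun y hy => ?_⟩
  obtain ⟨c', h0, hc'⟩ := exists_solution_of_lipschitz hG hGb y hT
  have hcG : ∀ s ∈ Set.Icc a' b', HasDerivAt c (G (c s)) s := fun s hs => by
    rw [hV (hCV ⟨s, hs, rfl⟩)]
    exact (hc s (hsub hs)).2
  have key : ∀ t : ℝ, t ≤ T → dist y (c 0) * Real.exp (K * t) < min ε η := fun t ht => by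
    calc dist y (c 0) * Real.exp (K * t) ≤ dist y (c 0) * Real.exp (K * T) := by gcongr
      _ < (min ε η * Real.exp (-(K * T))) * Real.exp (K * T) := by gcongr
      _ = min ε η := by rw [mul_assoc, ← Real.exp_add]; simp
  have hdist : ∀ s ∈ Set.Ioo a' b', dist (c' s) (c s) < min ε η := by
    intro s hs
    rcases le_total 0 s with h | h
    · have hI : ∀ t ∈ Set.Icc 0 s, t ∈ Set.Ioo (-T) T ∧ t ∈ Set.Icc a' b' := fun t ht =>
        ⟨⟨by linarith [ht.1], by linarith [ht.2, hs.2, ha'.2]⟩,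
          by linarith [ht.1, ha'.2], by linarith [ht.2, hs.2]⟩
      have := dist_le_of_trajectories_ODE (v := fun _ => G) (K := K) (a := 0) (b := s)
        (f := c') (g := c) (δ := dist y (c 0)) (fun _ => hG)
        (fun t ht => (hc' t (hI t ht).1).continuousAt.continuousWithinAt)
        (fun t ht => (hc' t (hI t (Set.Ico_subset_Icc_self ht)).1).hasDerivWithinAt)
        (fun t ht => (hcG t (hI t ht).2).continuousAt.continuousWithinAt)
        (fun t ht => (hcG t (hI t (Set.Ico_subset_Icc_self ht)).2).hasDerivWithinAt)
        (by rw [h0]) s ⟨h, le_rfl⟩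
      exact this.trans_lt (by rw [sub_zero]; exact key s (by linarith [hs.2, ha'.2]))
    · have hI : ∀ t ∈ Set.Icc 0 (-s), -t ∈ Set.Ioo (-T) T ∧ -t ∈ Set.Icc a' b' := fun t ht =>
        ⟨⟨by linarith [ht.2, hs.1, hb'.1], by linarith [ht.1]⟩,
          by linarith [ht.2, hs.1], by linarith [ht.1, hb'.1]⟩
      have hd : ∀ (d : ℝ → E) (t : ℝ), HasDerivAt d (G (d (-t))) (-t) →
          HasDerivAt (fun t => d (-t)) (-G (d (-t))) t := fun d t h => by
        simpa using! h.scomp t (hasDerivAt_neg t)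
      have := dist_le_of_trajectories_ODE (v := fun _ x => -G x) (K := K) (a := 0) (b := -s)
        (f := fun t => c' (-t)) (g := fun t => c (-t)) (δ := dist y (c 0)) (fun _ => hG.neg)
        (fun t ht => (hd _ _ (hc' _ (hI t ht).1)).continuousAt.continuousWithinAt)
        (fun t ht => (hd _ _ (hc' _ (hI t (Set.Ico_subset_Icc_self ht)).1)).hasDerivWithinAt)
        (fun t ht => (hd _ _ (hcG _ (hI t ht).2)).continuousAt.continuousWithinAt)
        (fun t ht => (hd _ _ (hcG _ (hI t (Set.Ico_subset_Icc_self ht)).2)).hasDerivWithinAt)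
        (by simp [h0]) (-s) ⟨by linarith, le_rfl⟩
      simp only [neg_neg, sub_zero] at this
      exact this.trans_lt (key _ (by linarith [hs.1, hb'.1]))
  have hmem : ∀ s ∈ Set.Ioo a' b', c' s ∈ V := fun s hs =>
    hηV (Metric.mem_thickening_iff.2 ⟨c s, ⟨s, Set.Ioo_subset_Icc_self hs, rfl⟩,
      (hdist s hs).trans_le (min_le_right _ _)⟩)
  refine ⟨c', h0, fun s hs => ⟨hVU (hmem s hs), ?_⟩, fun s hs =>
    (hdist s hs).trans_le (min_le_left _ _)⟩
  rw [← hV (hmem s hs)]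
  exact hc' s ⟨by linarith [hs.1, hb'.1], by linarith [hs.2, ha'.2]⟩

end Lipschitz

section Regular
variable {E : Type*} [NormedAddCommGroup E] [NormedSpace ℝ E]

/-- The field `F` has a well behaved local flow on `M`: orbits are unique, `M ∩ W` is invariant,
and orbits in `W` depend continuously, within `M`, on their initial point. -/
structure IsRegularFlow (M : Set E) (F : E → E) (W : Set E) : Prop where
  eqOn : ∀ {a b : ℝ} {c₁ c₂ : ℝ → E} {s₀ : ℝ}, IsSolutionOn M F a b c₁ → IsSolutionOn M F a b c₂ →
    s₀ ∈ Set.Ioo a b → c₁ s₀ = c₂ s₀ → Set.EqOn c₁ c₂ (Set.Ioo a b)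
  isOpen : IsOpen W
  continuousAt : ∀ {x : E}, x ∈ W → ContinuousAt F x
  mem : ∀ {a b : ℝ} {c : ℝ → E} {s₀ : ℝ}, IsSolutionOn M F a b c → s₀ ∈ Set.Ioo a b → c s₀ ∈ W →
    ∀ s ∈ Set.Ioo a b, c s ∈ W
  exists_near : ∀ {a b : ℝ} {c : ℝ → E} {a' b' ε : ℝ}, IsSolutionOn M F a b c → c 0 ∈ W →
    a' ∈ Set.Ioo a 0 → b' ∈ Set.Ioo 0 b → 0 < ε →
    ∃ δ > 0, ∀ y ∈ M, dist y (c 0) < δ → ∃ c', c' 0 = y ∧ IsSolutionOn M F a' b' c' ∧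
      ∀ s ∈ Set.Ioo a' b', dist (c' s) (c s) < ε

variable {M W : Set E} {F : E → E}

theorem IsRegularFlow.reverse (h : IsRegularFlow M F W) : IsRegularFlow M (-F) W where
  eqOn := by
    intro a b c₁ c₂ s₀ h₁ h₂ hs he t ht
    have h₁' := h₁.reverse
    have h₂' := h₂.reverse
    rw [neg_neg] at h₁' h₂'
    have := h.eqOn (s₀ := -s₀) h₁' h₂' ⟨by linarith [hs.2], by linarith [hs.1]⟩ (by simpa)
      (x := -t) ⟨by linarith [ht.2], by linarith [ht.1]⟩
    simpa using this
  isOpen := h.isOpen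
  continuousAt hx := (h.continuousAt hx).neg
  mem := by
    intro a b c s₀ hc hs he t ht
    have hc' := hc.reverse
    rw [neg_neg] at hc'
    have := h.mem (s₀ := -s₀) hc' ⟨by linarith [hs.2], by linarith [hs.1]⟩ (by simpa)
      (-t) ⟨by linarith [ht.2], by linarith [ht.1]⟩
    simpa using this
  exists_near := by
    intro a b c a' b' ε hc h0 ha hb hε
    have hc' := hc.reverse
    rw [neg_neg] at hc'
    obtain ⟨δ, hδ, H⟩ := h.exists_near hc' (by simpa) (a' := -b') (b' := -a')
      ⟨by linarith [hb.2], by linarith [hb.1]⟩ ⟨by linarith [ha.2], by linarith [ha.1]⟩ hε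
    refine ⟨δ, hδ, fun y hy hd => ?_⟩
    obtain ⟨d, hd0, hd, hdc⟩ := H y hy (by simpa using hd)
    refine ⟨fun s => d (-s), by simpa using hd0, by simpa using hd.reverse, fun s hs => ?_⟩
    simpa using hdc (-s) ⟨by linarith [hs.2], by linarith [hs.1]⟩

theorem IsRegularFlow.flowsTo_unique (h : IsRegularFlow M F W) {x y y' : M} {t : ℝ}
    (h₁ : FlowsTo M F x t y) (h₂ : FlowsTo M F x t y') : y = y' := by
  obtain ⟨a, b, c, h0, ht, hc, e0, e1⟩ := h₁
  obtain ⟨a', b', c', h0', ht', hc', e0', e1'⟩ := h₂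
  have hm : ∀ s, s ∈ Set.Ioo a b → s ∈ Set.Ioo a' b' → s ∈ Set.Ioo (max a a') (min b b') :=
    fun s hs hs' => ⟨max_lt hs.1 hs'.1, lt_min hs.2 hs'.2⟩
  have := h.eqOn (IsSolutionOn.mono hc (le_max_left a a') (min_le_left b b'))
    (IsSolutionOn.mono hc' (le_max_right a a') (min_le_right b b')) (hm 0 h0 h0')
    (e0.trans e0'.symm) (hm t ht ht')
  exact Subtype.ext (e1.symm.trans (this.trans e1'))

theorem IsRegularFlow.flowsTo_eq (h : IsRegularFlow M F W) {a b : ℝ} {c : ℝ → E}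
    (hc : IsSolutionOn M F a b c) {s t : ℝ} (hs : s ∈ Set.Ioo a b) (ht : t ∈ Set.Ioo a b)
    {x y : M} (hx : c s = x) (hy : FlowsTo M F x (t - s) y) : c t = y := by
  have h1 := hc.flowsTo hs ht
  have h2 : (⟨c s, (hc s hs).1⟩ : M) = x := Subtype.ext hx
  rw [h2] at h1
  exact congrArg Subtype.val (h.flowsTo_unique h1 hy)

theorem IsRegularFlow.flowsTo_trans (h : IsRegularFlow M F W) {x y z : M} {s t : ℝ}
    (h₁ : FlowsTo M F x s y) (h₂ : FlowsTo M F y t z) : FlowsTo M F x (s + t) z := by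
  obtain ⟨a, b, c, h0, ht, hc, e0, e1⟩ := h₁
  obtain ⟨a', b', c', h0', ht', hc', e0', e1'⟩ := h₂
  have hd := IsSolutionOn.shift hc' (-s)
  simp only [sub_neg_eq_add] at hd
  set d : ℝ → E := fun r => c' (r + -s) with hddef
  have hs1 : s ∈ Set.Ioo (a' + s) (b' + s) := ⟨by linarith [h0'.1], by linarith [h0'.2]⟩
  have hst : s + t ∈ Set.Ioo (a' + s) (b' + s) := ⟨by linarith [ht'.1], by linarith [ht'.2]⟩
  have hds : d s = y := by simp [hddef, e0']
  have hdt : d (s + t) = z := by simp [hddef, e1']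
  generalize a' + s = a₂ at *
  generalize b' + s = b₂ at *
  have heq : ∀ r ∈ Set.Ioo a b, r ∈ Set.Ioo a₂ b₂ → c r = d r := fun r hr hr' =>
    h.eqOn (IsSolutionOn.mono hc (le_max_left a a₂) (min_le_left b b₂))
      (IsSolutionOn.mono hd (le_max_right a a₂) (min_le_right b b₂)) (s₀ := s)
      ⟨max_lt ht.1 hs1.1, lt_min ht.2 hs1.2⟩ (e1.trans hds.symm)
      ⟨max_lt hr.1 hr'.1, lt_min hr.2 hr'.2⟩
  classical
  let e : ℝ → E := fun r => if r ∈ Set.Ioo a b then c r else d r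
  have he1 : ∀ r ∈ Set.Ioo a b, e r = c r := fun r hr => if_pos hr
  have he2 : ∀ r ∈ Set.Ioo a₂ b₂, e r = d r := fun r hr => by
    by_cases h' : r ∈ Set.Ioo a b
    · rw [he1 r h', heq r h' hr]
    · exact if_neg h'
  have hcov : ∀ r ∈ Set.Ioo (min a a₂) (max b b₂), r ∈ Set.Ioo a b ∨ r ∈ Set.Ioo a₂ b₂ := by
    rintro r ⟨h1, h2⟩
    rw [min_lt_iff] at h1
    rw [lt_max_iff] at h2
    by_contra! hcon
    simp only [Set.mem_Ioo, not_and, not_lt] at hcon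
    obtain ⟨q1, q2⟩ := hcon
    rcases h1 with h1 | h1
    · have := q1 h1
      have h2 := h2.resolve_left this.not_gt
      linarith [q2 (by linarith [ht.2, hs1.1])]
    · have := q2 h1
      have h2 := h2.resolve_right this.not_gt
      linarith [q1 (by linarith [hs1.2, ht.1])]
  refine ⟨min a a₂, max b b₂, e, ⟨(min_le_left _ _).trans_lt h0.1, h0.2.trans_le (le_max_left _ _)⟩,
    ⟨(min_le_right _ _).trans_lt hst.1, hst.2.trans_le (le_max_right _ _)⟩, fun r hr => ?_,
    (he1 0 h0).trans e0, (he2 _ hst).trans hdt⟩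
  rcases hcov r hr with hr' | hr'
  · rw [he1 r hr']
    exact ⟨(hc r hr').1, (hc r hr').2.congr_of_eventuallyEq
      (Filter.eventually_of_mem (isOpen_Ioo.mem_nhds hr') he1)⟩
  · rw [he2 r hr']
    exact ⟨(hd r hr').1, (hd r hr').2.congr_of_eventuallyEq
      (Filter.eventually_of_mem (isOpen_Ioo.mem_nhds hr') he2)⟩

end Regular
end Conley

/-! ### Crossing the boundary of an isolating block -/

namespace Conley

theorem _root_.IsPreconnected.inter_frontier_nonempty_of_mem {X : Type*} [TopologicalSpace X]
    {s B : Set X} (hs : IsPreconnected s) {x y : X} (hx : x ∈ s) (hxB : x ∈ B) (hy : y ∈ s)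
    (hyB : y ∉ B) : ∃ z ∈ s, z ∈ frontier B := by
  by_contra! h
  have hmem : ∀ z ∈ s, z ∈ interior B ∪ (closure B)ᶜ := fun z hz => by
    by_contra hz'
    simp only [Set.mem_union, Set.mem_compl_iff, not_or, not_not] at hz'
    exact h z hz ⟨hz'.2, hz'.1⟩
  obtain ⟨z, -, h1, h2⟩ := hs (interior B) (closure B)ᶜ isOpen_interior
    isClosed_closure.isOpen_compl hmem ⟨x, hx, (hmem x hx).resolve_right fun h' =>
      h' (subset_closure hxB)⟩ ⟨y, hy, (hmem y hy).resolve_left fun h' => hyB (interior_subset h')⟩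
  exact h2 (subset_closure (interior_subset h1))

variable {E : Type*} [NormedAddCommGroup E] [NormedSpace ℝ E] {M W : Set E} {F : E → E} {k : ℕ}
  {B : Set M} {a b : ℝ} {c : ℝ → E}

theorem IsSolutionOn.exists_mem_frontier (hc : IsSolutionOn M F a b c) {s t : ℝ}
    (hs : s ∈ Set.Ioo a b) (ht : t ∈ Set.Ioo a b) (hsB : c s ∈ Subtype.val '' B)
    (htB : c t ∉ Subtype.val '' B) :
    ∃ r ∈ Set.uIcc s t, c r ∈ Subtype.val '' frontier B := by
  have hsub : Set.uIcc s t ⊆ Set.Ioo a b := Set.ordConnected_Ioo.uIcc_subset hs ht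
  let γ : Set.uIcc s t → M := fun r => ⟨c r, (hc r (hsub r.2)).1⟩
  have hγ : Continuous γ :=
    Continuous.subtype_mk ((hc.continuousOn.mono hsub).domRestrict) _
  have hpre : IsPreconnected (Set.range γ) := by
    have : PreconnectedSpace (Set.uIcc s t) :=
      Subtype.preconnectedSpace Set.ordConnected_uIcc.isPreconnected
    exact isPreconnected_range hγ
  obtain ⟨z, ⟨r, rfl⟩, hz⟩ := hpre.inter_frontier_nonempty_of_mem (B := B)
    ⟨⟨s, Set.left_mem_uIcc⟩, rfl⟩
    (by obtain ⟨w, hw, hw'⟩ := hsB; exact (Subtype.ext hw' : w = γ ⟨s, _⟩) ▸ hw)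
    ⟨⟨t, Set.right_mem_uIcc⟩, rfl⟩ (fun h => htB ⟨_, h, rfl⟩)
  exact ⟨r, r.2, _, hz, rfl⟩

/-! ### Time reversal of blocks -/

theorem ingress_neg : ingress M (-F) B = egress M F B := by
  ext x
  refine and_congr_right fun _ => exists_congr fun ε => and_congr_right fun _ => ?_
  refine ⟨fun h t ht y hy => h (-t) ⟨by linarith [ht.2], by linarith [ht.1]⟩ y
    (flowsTo_neg.2 (by simpa using hy)), fun h t ht y hy => h (-t) ⟨by linarith [ht.2],
    by linarith [ht.1]⟩ y (flowsTo_neg.1 hy)⟩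

theorem egress_neg : egress M (-F) B = ingress M F B := by
  rw [← ingress_neg, neg_neg]

theorem tangency_neg : tangency M (-F) k B = tangency M F k B := by
  ext x
  simp [tangency, IsTangentTo]

theorem IsIsolatingBlock.reverse (hB : IsIsolatingBlock M F k B) :
    IsIsolatingBlock M (-F) k B where
  isCompact := hB.isCompact
  interior_nonempty := hB.interior_nonempty
  boundary_smooth := hB.boundary_smooth
  tangency_eq := by rw [tangency_neg, ingress_neg, egress_neg, hB.tangency_eq, Set.inter_comm]
  tangency_smooth := by rw [tangency_neg]; exact hB.tangency_smooth

/-! ### Entering and leaving an isolating block -/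

/-- At a boundary point where the field is not tangent, a component of a defining map of the boundary
is strictly monotone along all orbits nearby, so none of them meets the boundary twice. -/
theorem exists_ball_transverse {S : Set E} {p : E} (hF : ContinuousAt F p)
    (hS : IsSmoothSubmanifold S k) (hp : p ∈ S) (ht : ¬ IsTangentTo S k p (F p)) :
    ∃ η > 0, ∀ (a b : ℝ) (d : ℝ → E), IsSolutionOn M F a b d →
      (∀ s ∈ Set.Ioo a b, d s ∈ Metric.ball p η) → ∀ s ∈ Set.Ioo a b, ∀ s' ∈ Set.Ioo a b,
      s < s' → d s ∈ S → d s' ∉ S := by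
  obtain ⟨G, hG⟩ := hS p hp
  have hG' := hG
  obtain ⟨O, hO, hpO, hGO, -, hSO⟩ := hG'
  have hne : fderiv ℝ G p (F p) ≠ 0 := fun h => ht ⟨G, hG, h⟩
  obtain ⟨i, hi⟩ := Function.ne_iff.1 hne
  set e := fderiv ℝ G p (F p) i with he
  have hcont : ContinuousAt (fun y => e * fderiv ℝ G y (F y) i) p := by
    have h1 : ContinuousAt (fderiv ℝ G) p :=
      (hGO.continuousOn_fderiv_of_isOpen hO (by simp)).continuousAt (hO.mem_nhds hpO)
    have h2 := h1.clm_apply hF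
    exact continuousAt_const.mul ((continuous_apply i).continuousAt.comp h2)
  have hpos : 0 < e * fderiv ℝ G p (F p) i := by
    rw [← he]; exact mul_self_pos.2 hi
  obtain ⟨η, hη, hball⟩ := Metric.mem_nhds_iff.1
    (Filter.inter_mem (hO.mem_nhds hpO) (hcont.eventually (lt_mem_nhds hpos)))
  refine ⟨η, hη, fun a b d hd hdb s hs s' hs' hlt h1 h2 => ?_⟩
  have hsub : Set.Icc s s' ⊆ Set.Ioo a b := Set.Icc_subset_Ioo hs.1 hs'.2
  have hder : ∀ r ∈ Set.Icc s s', HasDerivAt (fun r => e * G (d r) i)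
      (e * fderiv ℝ G (d r) (F (d r)) i) r := fun r hr => by
    have h3 : HasFDerivAt G (fderiv ℝ G (d r)) (d r) :=
      ((hGO.contDiffAt (hO.mem_nhds (hball (hdb r (hsub hr))).1)).differentiableAt
        (by simp)).hasFDerivAt
    exact (hasDerivAt_pi.1 (h3.comp_hasDerivAt r (hd r (hsub hr)).2) i).const_mul e
  have hmono : StrictMonoOn (fun r => e * G (d r) i) (Set.Icc s s') := by
    refine strictMonoOn_of_deriv_pos (convex_Icc s s')
      (fun r hr => (hder r hr).continuousAt.continuousWithinAt) fun r hr => ?_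
    rw [interior_Icc] at hr
    have hr' := Set.Ioo_subset_Icc_self hr
    rw [(hder r hr').deriv]
    exact (hball (hdb r (hsub hr'))).2
  have hz : ∀ r ∈ Set.Ioo a b, d r ∈ S → G (d r) = 0 := fun r hr h =>
    (hSO.subset ⟨h, (hball (hdb r hr)).1⟩ : d r ∈ {x ∈ O | G x = 0}).2
  have := hmono ⟨le_rfl, hlt.le⟩ ⟨hlt.le, le_rfl⟩ hlt
  simp [hz s hs h1, hz s' hs' h2] at this

/-- A boundary point whose orbit is in the interior of the block for small positive times is an
ingress point. Otherwise the orbit would also be in the block at some small negative time; it crosses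
the boundary transversally, and the orbit of a nearby point outside the block would cross the
boundary twice. -/
theorem IsIsolatingBlock.mem_ingress (hreg : IsRegularFlow M F W) (hB : IsIsolatingBlock M F k B)
    (hc : IsSolutionOn M F a b c) (h0 : (0 : ℝ) ∈ Set.Ioo a b) {x : M} (hx : c 0 = x)
    (hxW : (x : E) ∈ W) (hxf : x ∈ frontier B) {b' : ℝ} (hb' : b' ∈ Set.Ioo 0 b)
    (hint : ∀ s ∈ Set.Ioo 0 b', c s ∈ Subtype.val '' interior B) : x ∈ ingress M F B := by
  have hBc : IsClosed B := hB.isCompact.isClosed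
  have hc0 : ∀ t ∈ Set.Ioo a b, ∀ y : M, FlowsTo M F x t y → c t = y := fun t ht y hy =>
    hreg.flowsTo_eq hc h0 ht hx (by simpa using hy)
  refine ⟨hxf, ?_⟩
  by_contra! hcon
  have htan : ¬ IsTangentTo (Subtype.val '' frontier B) (k + 1) (x : E) (F x) := by
    intro h
    have h' : x ∈ tangency M F (k + 1) B := ⟨hxf, h⟩
    rw [hB.tangency_eq] at h'
    obtain ⟨-, -, ε, hε, H⟩ := h'
    have ht1 : min ε b' / 2 ∈ Set.Ioo 0 b' :=
      ⟨by have := hb'.1; positivity, by linarith [min_le_right ε b', hb'.1]⟩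
    have ht2 : min ε b' / 2 ∈ Set.Ioo 0 ε := ⟨ht1.1, by linarith [min_le_left ε b']⟩
    have ht3 : min ε b' / 2 ∈ Set.Ioo a b := ⟨h0.1.trans ht1.1, ht1.2.trans hb'.2⟩
    obtain ⟨w, hw, hw'⟩ := hint _ ht1
    have hf := hc.flowsTo h0 ht3
    simp only [hx, sub_zero] at hf
    refine H _ ht2 _ hf ?_
    have : w = ⟨c (min ε b' / 2), (hc _ ht3).1⟩ := Subtype.ext hw'
    exact this ▸ interior_subset hw
  obtain ⟨η, hη, htr⟩ := exists_ball_transverse (M := M) (hreg.continuousAt hxW) hB.boundary_smooth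
    ⟨x, hxf, rfl⟩ htan
  have hcont : ContinuousAt c 0 := (hc 0 h0).2.continuousAt
  obtain ⟨τ, hτ, hτc⟩ := Metric.continuousAt_iff.1 hcont (η / 2) (by positivity)
  obtain ⟨τ', hτ', hτa⟩ : ∃ τ', 0 < τ' ∧ τ' < τ ∧ τ' < b' ∧ τ' < -a := by
    obtain ⟨τ', h1, h2⟩ := exists_between
      (lt_min hτ (lt_min hb'.1 (by linarith [h0.1] : (0 : ℝ) < -a)))
    simp only [lt_min_iff] at h2
    exact ⟨τ', h1, h2.1, h2.2.1, h2.2.2⟩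
  obtain ⟨hτ1, hτ2, hτ3⟩ := hτa
  have hIoo : ∀ s ∈ Set.Ioo (-τ') τ', s ∈ Set.Ioo a b := fun s hs =>
    ⟨by linarith [hs.1], by linarith [hs.2, hb'.2]⟩
  have hcb : ∀ s ∈ Set.Ioo (-τ') τ', dist (c s) x < η / 2 := fun s hs => by
    rw [← hx]
    exact hτc (by rw [Real.dist_eq, sub_zero, abs_lt]; constructor <;> linarith [hs.1, hs.2])
  have hsol := hc.mono (a' := -τ') (b' := τ') (by linarith) (by linarith [hb'.2])
  obtain ⟨t, ht, y, hy, hyB⟩ := hcon τ' hτ'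
  have ht' : t ∈ Set.Ioo (-τ') τ' := ⟨ht.1, ht.2.trans hτ'⟩
  have hcty : c t = y := hc0 t (hIoo t ht') y hy
  have hyint : y ∈ interior B := by
    by_contra hy'
    refine htr _ _ c hsol (fun s hs => Metric.mem_ball.2 (by linarith [hcb s hs])) t ht' 0
      ⟨by linarith, hτ'⟩ ht.2 ⟨y, ⟨subset_closure hyB, hy'⟩, hcty.symm⟩ ⟨x, hxf, hx.symm⟩
  obtain ⟨V, hV, hVB⟩ := isOpen_induced_iff.1 (isOpen_interior (s := B))
  have hVi : ∀ p : M, (p : E) ∈ V → p ∈ interior B := fun p hp => by rw [← hVB]; exact hp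
  have hVi' : ∀ p : M, p ∈ interior B → (p : E) ∈ V := fun p hp => by rw [← hVB] at hp; exact hp
  have htV : c t ∈ V := hcty ▸ hVi' y hyint
  have hs2 : τ' / 2 ∈ Set.Ioo 0 b' := ⟨by positivity, by linarith⟩
  have hs2V : c (τ' / 2) ∈ V := by
    obtain ⟨w, hw, hw'⟩ := hint _ hs2
    exact hw' ▸ hVi' w hw
  obtain ⟨ε₁, hε₁, hb1⟩ := Metric.mem_nhds_iff.1 (hV.mem_nhds htV)
  obtain ⟨ε₂, hε₂, hb2⟩ := Metric.mem_nhds_iff.1 (hV.mem_nhds hs2V)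
  obtain ⟨a₁, ha₁, ha₁'⟩ := exists_between ht.1
  obtain ⟨δ, hδ, hnear⟩ := hreg.exists_near hsol (hx ▸ hxW) (a' := a₁) (b' := 3 * τ' / 4)
    (ε := min (η / 2) (min ε₁ ε₂)) ⟨ha₁, by linarith [ht.2]⟩ ⟨by positivity, by linarith⟩
    (by positivity)
  have hxcl : x ∈ closure Bᶜ := by
    rw [frontier_eq_closure_inter_closure] at hxf
    exact hxf.2
  obtain ⟨y₀, hy₀, hy₀d⟩ := Metric.mem_closure_iff.1 hxcl δ hδ
  obtain ⟨d, hd0, hd, hdc⟩ := hnear y₀ y₀.2 (by rw [hx, dist_comm]; exact hy₀d)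
  have hm : ∀ s ∈ Set.Ioo a₁ (3 * τ' / 4), dist (d s) (c s) < η / 2 ∧ dist (d s) (c s) < ε₁ ∧
      dist (d s) (c s) < ε₂ := fun s hs => by
    have := hdc s hs
    simpa only [lt_min_iff] using this
  have I0 : (0 : ℝ) ∈ Set.Ioo a₁ (3 * τ' / 4) := ⟨by linarith [ht.2], by positivity⟩
  have It : t ∈ Set.Ioo a₁ (3 * τ' / 4) := ⟨ha₁', by linarith [ht.2]⟩
  have I2 : τ' / 2 ∈ Set.Ioo a₁ (3 * τ' / 4) := ⟨by linarith [ht.2], by linarith⟩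
  have hinB : ∀ s ∈ Set.Ioo a₁ (3 * τ' / 4), d s ∈ V → d s ∈ Subtype.val '' B := fun s hs h =>
    ⟨⟨d s, (hd s hs).1⟩, interior_subset (hVi _ h), rfl⟩
  have h0B : d 0 ∉ Subtype.val '' B := by
    rw [hd0]
    rintro ⟨w, hw, hw'⟩
    exact hy₀ (Subtype.ext hw' ▸ hw)
  have h0f : d 0 ∉ Subtype.val '' frontier B := fun h => h0B (Set.image_mono hBc.frontier_subset h)
  obtain ⟨r₁, hr₁, hr₁f⟩ := hd.exists_mem_frontier It I0 (hinB t It (hb1 (hm t It).2.1)) h0B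
  obtain ⟨r₂, hr₂, hr₂f⟩ := hd.exists_mem_frontier I2 I0 (hinB _ I2 (hb2 (hm _ I2).2.2)) h0B
  rw [Set.uIcc_of_le ht.2.le] at hr₁
  rw [Set.uIcc_of_ge (by positivity)] at hr₂
  have hr₁0 : r₁ < 0 := lt_of_le_of_ne hr₁.2 fun h => h0f (h ▸ hr₁f)
  have hr₂0 : 0 < r₂ := lt_of_le_of_ne hr₂.1 fun h => h0f (h ▸ hr₂f)
  refine htr _ _ d hd (fun s hs => Metric.mem_ball.2 ?_) r₁ ⟨by linarith [hr₁.1], by linarith⟩ r₂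
    ⟨by linarith [ht.2], by linarith [hr₂.2]⟩ (hr₁0.trans hr₂0) hr₁f hr₂f
  have h1 := hcb s ⟨by linarith [hs.1], by linarith [hs.2]⟩
  have h2 := (hm s hs).1
  have h3 := dist_triangle (d s) (c s) x
  linarith

/-- An orbit which is in the interior of the block at time `0`, but was not at some earlier time, has a
last entry point. -/
theorem IsIsolatingBlock.exists_last_entry (hreg : IsRegularFlow M F W)
    (hB : IsIsolatingBlock M F k B) (hc : IsSolutionOn M F a b c) (h0 : (0 : ℝ) ∈ Set.Ioo a b)
    (h0W : c 0 ∈ W) (h0B : c 0 ∈ Subtype.val '' interior B) {t : ℝ} (ht : t ∈ Set.Ioo a 0)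
    (htB : c t ∉ Subtype.val '' interior B) :
    ∃ t₀ ∈ Set.Ico t 0, (∃ p ∈ ingress M F B, c t₀ = p) ∧
      ∀ s ∈ Set.Ioc t₀ 0, c s ∈ Subtype.val '' interior B := by
  have hBc : IsClosed B := hB.isCompact.isClosed
  obtain ⟨V, hV, hVB⟩ := isOpen_induced_iff.1 (isOpen_interior (s := B))
  have hsub : Set.Icc t 0 ⊆ Set.Ioo a b := Set.Icc_subset_Ioo ht.1 h0.2
  have hVi : ∀ s ∈ Set.Ioo a b, c s ∈ V ↔ c s ∈ Subtype.val '' interior B := fun s hs => by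
    rw [← hVB]
    constructor
    · exact fun h => ⟨⟨c s, (hc s hs).1⟩, h, rfl⟩
    · rintro ⟨w, hw, hw'⟩
      exact hw' ▸ hw
  have hcomp : IsCompact (Set.Icc t 0 ∩ c ⁻¹' Vᶜ) :=
    isCompact_Icc.of_isClosed_subset ((hc.continuousOn.mono hsub).preimage_isClosed_of_isClosed
      isClosed_Icc hV.isClosed_compl) Set.inter_subset_left
  obtain ⟨t₀, ⟨ht₀, ht₀V⟩, hmax⟩ := hcomp.exists_isGreatest
    ⟨t, ⟨le_rfl, ht.2.le⟩, fun h => htB ((hVi t ⟨ht.1, ht.2.trans h0.2⟩).1 h)⟩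
  have ht₀0 : t₀ < 0 := lt_of_le_of_ne ht₀.2 fun h => ht₀V (h ▸ (hVi 0 h0).2 h0B)
  have hin : ∀ s ∈ Set.Ioc t₀ 0, c s ∈ Subtype.val '' interior B := fun s hs => by
    have hs' : s ∈ Set.Icc t 0 := ⟨ht₀.1.trans hs.1.le, hs.2⟩
    by_contra hcon
    exact (hmax ⟨hs', fun h => hcon ((hVi s (hsub hs')).1 h)⟩).not_gt hs.1
  have ht₀I := hsub ht₀
  have hcl : c t₀ ∈ Subtype.val '' B := by
    have hcl' : IsClosed (Subtype.val '' B : Set E) :=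
      (hB.isCompact.image continuous_subtype_val).isClosed
    refine hcl'.mem_of_tendsto ((hc t₀ ht₀I).2.continuousAt.mono_left nhdsWithin_le_nhds)
      (b := 𝓝[>] t₀) ?_
    filter_upwards [Ioo_mem_nhdsGT ht₀0] with s hs
    exact Set.image_mono interior_subset (hin s (Set.Ioo_subset_Ioc_self hs))
  obtain ⟨p, hp, hpc⟩ := hcl
  refine ⟨t₀, ⟨ht₀.1, ht₀0⟩, ⟨p, ?_, hpc.symm⟩, hin⟩
  have hpf : p ∈ frontier B := by
    rw [hBc.frontier_eq]
    exact ⟨hp, fun h => ht₀V ((hVi t₀ ht₀I).2 ⟨p, h, hpc⟩)⟩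
  refine hB.mem_ingress hreg (hc.shift t₀) ⟨by linarith [ht₀I.1], by linarith [ht₀I.2]⟩
    (by simpa using hpc.symm) (hpc ▸ hreg.mem hc h0 h0W t₀ ht₀I) hpf (b' := -t₀)
    ⟨by linarith, by linarith [h0.2]⟩ fun s hs => hin _ ⟨by linarith [hs.1], by linarith [hs.2]⟩

/-- An orbit which leaves the interior of the block also leaves the block. -/
theorem IsIsolatingBlock.exists_exit (hreg : IsRegularFlow M F W)
    (hB : IsIsolatingBlock M F k B) (hc : IsSolutionOn M F a b c) (h0 : (0 : ℝ) ∈ Set.Ioo a b)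
    (h0W : c 0 ∈ W) (h0B : c 0 ∈ Subtype.val '' interior B) {t : ℝ} (ht : t ∈ Set.Ioo 0 b)
    (htB : c t ∉ Subtype.val '' interior B) :
    ∃ t₂ ∈ Set.Ioo 0 b, c t₂ ∉ Subtype.val '' B := by
  obtain ⟨t₀, ht₀, ⟨p, hp, hpc⟩, -⟩ := hB.reverse.exists_last_entry hreg.reverse hc.reverse
    (by constructor <;> linarith [h0.1, h0.2]) (by simpa) (by simpa using! h0B)
    (t := -t) ⟨by linarith [ht.2], by linarith [ht.1]⟩ (by rw [neg_neg]; exact htB)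
  rw [ingress_neg] at hp
  obtain ⟨-, ε, hε, H⟩ := hp
  have hlt : (0 : ℝ) < min ε (b + t₀) := lt_min hε (by linarith [ht₀.1, ht.2])
  have h1 := min_le_left ε (b + t₀)
  have h2 := min_le_right ε (b + t₀)
  have ha0 := h0.1
  have hI : -t₀ + min ε (b + t₀) / 2 ∈ Set.Ioo a b :=
    ⟨by linarith [ht₀.2], by linarith⟩
  refine ⟨-t₀ + min ε (b + t₀) / 2, ⟨by linarith [ht₀.2], hI.2⟩, ?_⟩
  have hf := hc.flowsTo (s := -t₀) ⟨by linarith [ht₀.2], by linarith [ht₀.1, ht.2]⟩ hI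
  simp only [hpc, add_sub_cancel_left] at hf
  rintro ⟨w, hw, hw'⟩
  exact H _ ⟨by linarith, by linarith⟩ _ hf ((Subtype.ext hw' : w = ⟨c _, _⟩) ▸ hw)

/-- The last entry point depends continuously on the orbit. -/
theorem IsIsolatingBlock.exists_entry_near (hreg : IsRegularFlow M F W)
    (hB : IsIsolatingBlock M F k B) (hc : IsSolutionOn M F a b c) (h0 : (0 : ℝ) ∈ Set.Ioo a b)
    (h0W : c 0 ∈ W) (h0B : c 0 ∈ Subtype.val '' interior B) {t : ℝ} (ht : t ∈ Set.Ioo a 0)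
    (htB : c t ∉ Subtype.val '' interior B) :
    ∃ p ∈ ingress M F B, ∀ ε > 0, ∃ δ > 0, ∀ x : M, dist (x : E) (c 0) < δ →
      ∃ q ∈ ingress M F B, dist q p < ε ∧ ∃ τ > 0, FlowsTo M F q τ x ∧
        ∀ s ∈ Set.Ioc 0 τ, ∀ y, FlowsTo M F q s y → y ∈ interior B := by
  obtain ⟨t₀, ht₀, ⟨p, hp, hpc⟩, hin⟩ := hB.exists_last_entry hreg hc h0 h0W h0B ht htB
  refine ⟨p, hp, fun ε hε => ?_⟩
  obtain ⟨-, ε₁, hε₁, hout⟩ := hp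
  have ht₀I : t₀ ∈ Set.Ioo a b := ⟨ht.1.trans_le ht₀.1, ht₀.2.trans h0.2⟩
  obtain ⟨τ₀, hτ₀, hτc⟩ := Metric.continuousAt_iff.1 (hc t₀ ht₀I).2.continuousAt (ε / 2)
    (by positivity)
  obtain ⟨τ, hτ, hτ1, hτ2, hτ3, hτ4⟩ :
      ∃ τ, 0 < τ ∧ τ < τ₀ ∧ τ < ε₁ ∧ τ < t₀ - a ∧ τ < -t₀ := by
    obtain ⟨τ, h1, h2⟩ := exists_between (lt_min hτ₀ (lt_min hε₁
      (lt_min (by linarith [ht₀I.1] : (0 : ℝ) < t₀ - a) (by linarith [ht₀.2] : (0 : ℝ) < -t₀))))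
    simp only [lt_min_iff] at h2
    exact ⟨τ, h1, h2.1, h2.2.1, h2.2.2.1, h2.2.2.2⟩
  have hLI : t₀ - τ ∈ Set.Ioo a b := ⟨by linarith, by linarith [ht₀I.2]⟩
  have hL : c (t₀ - τ) ∈ (Subtype.val '' B)ᶜ := by
    have hf := hc.flowsTo ht₀I hLI
    simp only [hpc, sub_sub_cancel_left] at hf
    rintro ⟨w, hw, hw'⟩
    exact hout _ ⟨by linarith, by linarith⟩ _ hf ((Subtype.ext hw' : w = ⟨c _, _⟩) ▸ hw)
  have hBo : IsOpen (Subtype.val '' B : Set E)ᶜ :=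
    (hB.isCompact.image continuous_subtype_val).isClosed.isOpen_compl
  obtain ⟨ε₃, hε₃, hb3⟩ := Metric.mem_nhds_iff.1 (hBo.mem_nhds hL)
  obtain ⟨V, hV, hVB⟩ := isOpen_induced_iff.1 (isOpen_interior (s := B))
  have hVi : ∀ p : M, (p : E) ∈ V → p ∈ interior B := fun p hp => by rw [← hVB]; exact hp
  have hsub : Set.Icc (t₀ + τ) 0 ⊆ Set.Ioo a b :=
    Set.Icc_subset_Ioo (by linarith [ht₀I.1]) h0.2
  obtain ⟨ε₂, hε₂, hb2⟩ := (isCompact_Icc.image_of_continuousOn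
    (hc.continuousOn.mono hsub)).exists_thickening_subset_open hV (by
      rintro _ ⟨s, hs, rfl⟩
      obtain ⟨w, hw, hw'⟩ := hin s ⟨by linarith [hs.1], hs.2⟩
      rw [← hVB] at hw
      exact hw' ▸ hw)
  obtain ⟨a₁, ha₁, ha₁'⟩ := exists_between hLI.1
  obtain ⟨δ, hδ, hnear⟩ := hreg.exists_near hc h0W (a' := a₁) (b' := b / 2)
    (ε := min (ε / 2) (min ε₂ ε₃)) ⟨ha₁, by linarith [ht₀.2]⟩
    ⟨by linarith [h0.2], by linarith [h0.2]⟩ (by positivity)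
  obtain ⟨δ', hδ', hW'⟩ := Metric.mem_nhds_iff.1 (hreg.isOpen.mem_nhds h0W)
  refine ⟨min δ δ', by positivity, fun x hx => ?_⟩
  obtain ⟨d, hd0, hd, hdc⟩ := hnear x x.2 (hx.trans_le (min_le_left _ _))
  have I0 : (0 : ℝ) ∈ Set.Ioo a₁ (b / 2) := ⟨by linarith [ht₀.2], by linarith [h0.2]⟩
  have hm : ∀ s ∈ Set.Ioo a₁ (b / 2), dist (d s) (c s) < ε / 2 ∧ dist (d s) (c s) < ε₂ ∧
      dist (d s) (c s) < ε₃ := fun s hs => by simpa only [lt_min_iff] using hdc s hs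
  have hdV : ∀ s ∈ Set.Icc (t₀ + τ) 0, d s ∈ Subtype.val '' interior B := fun s hs => by
    have hs' : s ∈ Set.Ioo a₁ (b / 2) := ⟨by linarith [hs.1], by linarith [hs.2, h0.2]⟩
    exact ⟨⟨d s, (hd s hs').1⟩, hVi _ (hb2 (Metric.mem_thickening_iff.2
      ⟨c s, ⟨s, hs, rfl⟩, (hm s hs').2.1⟩)), rfl⟩
  have hd0B : d 0 ∈ Subtype.val '' interior B := hdV 0 ⟨by linarith, le_rfl⟩
  have IL : t₀ - τ ∈ Set.Ioo a₁ (b / 2) := ⟨ha₁', by linarith [ht₀.2, h0.2]⟩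
  have hdL : d (t₀ - τ) ∉ Subtype.val '' interior B := fun h =>
    hb3 (Metric.mem_ball.2 (hm _ IL).2.2) (Set.image_mono interior_subset h)
  have hd0W : d 0 ∈ W := hW' (Metric.mem_ball.2 (by rw [hd0]; exact hx.trans_le (min_le_right _ _)))
  obtain ⟨t₁, ht₁, ⟨q, hq, hqd⟩, hin'⟩ := hB.exists_last_entry hreg hd I0 hd0W hd0B
    (t := t₀ - τ) ⟨ha₁', by linarith [ht₀.2]⟩ hdL
  have ht₁' : t₁ < t₀ + τ := by
    by_contra! hcon
    obtain ⟨w, hw, hw'⟩ := hdV t₁ ⟨hcon, ht₁.2.le⟩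
    rw [hqd] at hw'
    exact hq.1.2 ((Subtype.ext hw' : w = q) ▸ hw)
  have I1 : t₁ ∈ Set.Ioo a₁ (b / 2) := ⟨by linarith [ht₁.1], by linarith [ht₁.2, h0.2]⟩
  refine ⟨q, hq, ?_, -t₁, by linarith [ht₁.2], ?_, fun s hs y hy => ?_⟩
  · have h1 : dist (d t₁) p ≤ dist (d t₁) (c t₁) + dist (c t₁) p := dist_triangle _ _ _
    have h2 : dist (c t₁) p < ε / 2 := by
      rw [← hpc]
      exact hτc (by rw [Real.dist_eq, abs_lt]; constructor <;> linarith [ht₁.1])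
    rw [hqd] at h1
    have h3 := (hm t₁ I1).1
    rw [hqd] at h3
    exact h1.trans_lt (by linarith)
  · have hf := hd.flowsTo I1 I0
    simpa only [hqd, hd0, zero_sub] using hf
  · have := hreg.flowsTo_eq hd I1 (t := t₁ + s) ⟨by linarith [hs.1, I1.1],
      by linarith [hs.2, h0.2]⟩ hqd (by simpa using hy)
    obtain ⟨w, hw, hw'⟩ := hin' (t₁ + s) ⟨by linarith [hs.1], by linarith [hs.2]⟩
    exact (Subtype.ext (hw'.trans this) : w = y) ▸ hw

end Conley

/-! ### The extended map across a block -/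

namespace Conley

variable {E : Type*} [NormedAddCommGroup E] [NormedSpace ℝ E] {M W : Set E} {F : E → E}
  {B : Set M} {a b : ℝ} {c : ℝ → E}

theorem IsSmoothMap.exists_dist_lt {A A' : Set M} {φ : A → A'} (hφ : IsSmoothMap φ) (p : A)
    {ε : ℝ} (hε : 0 < ε) :
    ∃ δ > 0, ∀ q : A, dist q p < δ → dist (φ q : M) (φ p : M) < ε := by
  obtain ⟨O, hO, hpO, g, hg, hgφ⟩ := hφ p
  have hcont : ContinuousAt g ((p : M) : E) := (hg.continuousOn).continuousAt (hO.mem_nhds hpO)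
  obtain ⟨δ₁, hδ₁, h1⟩ := Metric.continuousAt_iff.1 hcont ε hε
  obtain ⟨δ₂, hδ₂, h2⟩ := Metric.mem_nhds_iff.1 (hO.mem_nhds hpO)
  refine ⟨min δ₁ δ₂, by positivity, fun q hq => ?_⟩
  have hq' : dist ((q : M) : E) ((p : M) : E) < min δ₁ δ₂ := hq
  have h3 := h1 (hq'.trans_le (min_le_left _ _))
  rwa [hgφ q (h2 (hq'.trans_le (min_le_right _ _))), hgφ p hpO] at h3

/-- Let `p` be the entry point of an orbit through `x₀` that never leaves the block, and suppose that
orbits arbitrarily close to `x₀` go on, inside the block, to points arbitrarily close to `c 0`, where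
the orbit `c` leaves the block. Then a continuous extension of the map across the block sends `p` to
a point of `c`. -/
theorem IsRegularFlow.exists_extension_eq (hreg : IsRegularFlow M F W) (hB : IsCompact B)
    {φ : ingress M F B → egress M F B} (hφ : IsSmoothMap φ)
    (hext : ∀ x : ingress M F B, (x : M) ∉ forwardAsymptotic M F B → MapsAcross M F B x (φ x))
    (p : ingress M F B) {x₀ : E}
    (hp : ∀ ε > 0, ∃ δ > 0, ∀ x : M, dist (x : E) x₀ < δ →
      ∃ q ∈ ingress M F B, dist q p < ε ∧ ∃ τ > 0, FlowsTo M F q τ x ∧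
        ∀ s ∈ Set.Ioc 0 τ, ∀ y, FlowsTo M F q s y → y ∈ interior B)
    (hc : IsSolutionOn M F a b c) (h0 : (0 : ℝ) ∈ Set.Ioo a b) (h0W : c 0 ∈ W) {t₂ : ℝ}
    (ht₂ : t₂ ∈ Set.Ioo 0 b) (ht₂B : c t₂ ∉ Subtype.val '' B)
    (hpass : ∀ δ > 0, ∃ x y : M, dist (x : E) x₀ < δ ∧ dist (y : E) (c 0) < δ ∧
      ∃ S > 0, FlowsTo M F x S y ∧
        ∀ s ∈ Set.Icc 0 S, ∀ z, FlowsTo M F x s z → z ∈ interior B) :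
    ∃ s ∈ Set.Icc 0 t₂, ((φ p : M) : E) = c s := by
  have hsub : Set.Icc 0 t₂ ⊆ Set.Ioo a b := Set.Icc_subset_Ioo h0.1 ht₂.2
  have hcl : IsClosed (c '' Set.Icc 0 t₂) :=
    (isCompact_Icc.image_of_continuousOn (hc.continuousOn.mono hsub)).isClosed
  suffices h : ((φ p : M) : E) ∈ closure (c '' Set.Icc 0 t₂) by
    rw [hcl.closure_eq] at h
    obtain ⟨s, hs, he⟩ := h
    exact ⟨s, hs, he.symm⟩
  rw [Metric.mem_closure_iff]
  intro ε hε
  have hBo : IsOpen (Subtype.val '' B : Set E)ᶜ :=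
    (hB.image continuous_subtype_val).isClosed.isOpen_compl
  obtain ⟨ε₁, hε₁, hb1⟩ := Metric.mem_nhds_iff.1 (hBo.mem_nhds ht₂B)
  obtain ⟨b', hb', hb''⟩ := exists_between ht₂.2
  have ha0 := h0.1
  have ht0 := ht₂.1
  obtain ⟨δ₁, hδ₁, hnear⟩ := hreg.exists_near hc h0W (a' := a / 2) (b' := b')
    (ε := min (ε / 2) ε₁) ⟨by linarith, by linarith⟩ ⟨by linarith, hb''⟩ (by positivity)
  obtain ⟨δ₂, hδ₂, hφc⟩ := hφ.exists_dist_lt p (half_pos hε)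
  obtain ⟨δ₃, hδ₃, hentry⟩ := hp δ₂ hδ₂
  obtain ⟨x, y, hx, hy, S, hS, hxy, hxin⟩ := hpass (min δ₁ δ₃) (by positivity)
  obtain ⟨q, hq, hqp, τ, hτ, hqx, hqin⟩ := hentry x (hx.trans_le (min_le_right _ _))
  obtain ⟨d, hd0, hd, hdc⟩ := hnear y y.2 (hy.trans_le (min_le_left _ _))
  have I0 : (0 : ℝ) ∈ Set.Ioo (a / 2) b' := ⟨by linarith, by linarith⟩
  have I2 : t₂ ∈ Set.Ioo (a / 2) b' := ⟨by linarith, hb'⟩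
  have hdB : d t₂ ∉ Subtype.val '' B :=
    hb1 (Metric.mem_ball.2 ((hdc t₂ I2).trans_le (min_le_right _ _)))
  have hqy := hreg.flowsTo_trans hqx hxy
  have hyz := hd.flowsTo I0 I2
  have hy' : (⟨d 0, (hd 0 I0).1⟩ : M) = y := Subtype.ext hd0
  rw [hy', sub_zero] at hyz
  have hqz := hreg.flowsTo_trans hqy hyz
  have hzB : (⟨d t₂, (hd t₂ I2).1⟩ : M) ∉ B := fun h => hdB ⟨_, h, rfl⟩
  obtain ⟨T, -, hT, hqT⟩ := hext ⟨q, hq⟩ fun h => hzB (h.2 _ (by linarith) _ hqz)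
  have hTle : T ≤ τ + S + t₂ := hT.1 ⟨by linarith, _, hqz, hzB⟩
  have hTge : τ + S ≤ T := by
    refine hT.2 ?_
    rintro t ⟨ht, z, hz, hzB'⟩
    by_contra! hlt
    rcases le_or_gt t τ with h | h
    · exact hzB' (interior_subset (hqin t ⟨ht, h⟩ z hz))
    · exact hzB' (interior_subset (hxin (-τ + t) ⟨by linarith, by linarith⟩ z
        (hreg.flowsTo_trans hqx.symm hz)))
  have hyT := hreg.flowsTo_trans hqy.symm hqT
  have hIs : -(τ + S) + T ∈ Set.Ioo (a / 2) b' := ⟨by linarith, by linarith⟩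
  have hdT := hreg.flowsTo_eq hd I0 hIs hd0 (by simpa using hyT)
  refine ⟨_, ⟨-(τ + S) + T, ⟨by linarith, by linarith⟩, rfl⟩, ?_⟩
  have h1 : dist ((φ ⟨q, hq⟩ : M) : E) (φ p : M) < ε / 2 := hφc ⟨q, hq⟩ hqp
  have h2 := (hdc _ hIs).trans_le (min_le_left _ _)
  rw [hdT] at h2
  rw [dist_comm] at h1
  exact (dist_triangle _ _ _).trans_lt (by linarith)

end Conley

/-! ### The energy manifold and the flow near the collision manifold -/

namespace Kepler

/-- A solution of a homogeneous linear equation which vanishes once vanishes identically. -/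
theorem eq_zero_of_linear {y κ : ℝ → ℝ} {a b s₀ : ℝ} (hκ : ContinuousOn κ (Set.Ioo a b))
    (hy : ∀ s ∈ Set.Ioo a b, HasDerivAt y (κ s * y s) s) (hs₀ : s₀ ∈ Set.Ioo a b)
    (h0 : y s₀ = 0) : ∀ s ∈ Set.Ioo a b, y s = 0 := by
  intro s hs
  obtain ⟨a', ha', ha''⟩ := exists_between (lt_min hs₀.1 hs.1)
  obtain ⟨b', hb', hb''⟩ := exists_between (max_lt hs₀.2 hs.2)
  have hsub : Set.Icc a' b' ⊆ Set.Ioo a b := Set.Icc_subset_Ioo ha' hb''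
  obtain ⟨C, hC⟩ := isCompact_Icc.exists_bound_of_continuousOn (hκ.mono hsub)
  have hycont : ContinuousOn y (Set.Icc a' b') := fun t ht =>
    (hy t (hsub ht)).continuousAt.continuousWithinAt
  refine ODE_solution_unique_of_mem_Icc (v := fun t x => κ t * x) (s := fun _ => Set.univ)
    (K := C.toNNReal) (g := fun _ => 0) (t₀ := s₀) (fun t ht => ?_)
    ⟨ha''.trans_le (min_le_left _ _), (le_max_left _ _).trans_lt hb'⟩ hycont
    (fun t ht => hy t (hsub (Set.Ioo_subset_Icc_self ht))) (fun _ _ => trivial)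
    continuousOn_const (fun t _ => by simpa using hasDerivAt_const t (0 : ℝ))
    (fun _ _ => trivial) h0
    ⟨(ha''.trans_le (min_le_right _ _)).le, ((le_max_right _ _).trans_lt hb').le⟩
  refine (LipschitzWith.of_dist_le_mul fun x x' => ?_).lipschitzOnWith
  have h1 := hC t (Set.Ioo_subset_Icc_self ht)
  rw [Real.norm_eq_abs] at h1
  rw [Real.dist_eq, Real.dist_eq, ← mul_sub, abs_mul]
  gcongr
  exact h1.trans (Real.le_coe_toNNReal C)

section
variable {f : ℝ → ℝ} {rN rS K β γ h : ℝ}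

theorem IsSphericalRadius.hasDerivAt (hf : IsSphericalRadius f rN rS K) (r : ℝ) :
    HasDerivAt f (deriv f r) r :=
  (hf.smooth.differentiable (by simp)).differentiableAt.hasDerivAt

theorem IsSphericalRadius.contDiff_deriv (hf : IsSphericalRadius f rN rS K) :
    ContDiff ℝ ∞ (deriv f) :=
  (contDiff_infty_iff_deriv.1 hf.smooth).2

theorem IsSphericalRadius.hasDerivAt_deriv (hf : IsSphericalRadius f rN rS K) (r : ℝ) :
    HasDerivAt (deriv f) (deriv (deriv f) r) r :=
  (hf.contDiff_deriv.differentiable (by simp)).differentiableAt.hasDerivAt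

/-- The radius function is `f(r) = (|β|/√K) sin(√K (r - rN))`. -/
theorem IsSphericalRadius.eq_sin (hf : IsSphericalRadius f rN rS K)
    (hβ : ∀ r ∈ Set.Icc rN rS, -f r * deriv (deriv f) r + deriv f r ^ 2 = β ^ 2) {r : ℝ}
    (hr : r ∈ Set.Icc rN rS) :
    √K * f r = |β| * Real.sin (√K * (r - rN)) ∧ deriv f r = |β| * Real.cos (√K * (r - rN)) := by
  have hk := Real.sqrt_pos.2 hf.curvature_pos
  have hk2 : √K ^ 2 = K := Real.sq_sqrt hf.curvature_pos.le
  set k := √K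
  let e : ℝ → ℝ := fun r => (deriv f r - |β| * Real.cos (k * (r - rN))) ^ 2 +
    (k * f r - |β| * Real.sin (k * (r - rN))) ^ 2
  have he : ∀ r ∈ Set.Icc rN rS, HasDerivAt e 0 r := fun r hr => by
    have hl : HasDerivAt (fun r => k * (r - rN)) k r := by
      simpa using ((hasDerivAt_id r).sub_const rN).const_mul k
    have h1 := ((hf.hasDerivAt_deriv r).sub (hl.cos.const_mul |β|)).pow 2
    have h2 := (((hf.hasDerivAt r).const_mul k).sub (hl.sin.const_mul |β|)).pow 2
    refine (h1.add h2).congr_deriv ?_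
    rw [hf.curvature r hr]
    simp only [Pi.sub_apply]
    rw [← hk2]
    ring
  have hconst := constant_of_has_deriv_right_zero (f := e)
    (fun r hr => (he r hr).continuousAt.continuousWithinAt)
    (fun r hr => (he r (Set.Ico_subset_Icc_self hr)).hasDerivWithinAt) r hr
  have h0 : e rN = 0 := by simp [e, hf.north, hf.deriv_north hβ]
  rw [h0] at hconst
  have h1 := sq_nonneg (deriv f r - |β| * Real.cos (k * (r - rN)))
  have h2 := sq_nonneg (k * f r - |β| * Real.sin (k * (r - rN)))
  constructor
  · have : (k * f r - |β| * Real.sin (k * (r - rN))) ^ 2 = 0 := by linarith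
    linarith [pow_eq_zero_iff (two_ne_zero) |>.1 this]
  · have : (deriv f r - |β| * Real.cos (k * (r - rN))) ^ 2 = 0 := by linarith
    linarith [pow_eq_zero_iff (two_ne_zero) |>.1 this]

theorem IsSphericalRadius.sqrt_mul_sub (hf : IsSphericalRadius f rN rS K)
    (hβ : ∀ r ∈ Set.Icc rN rS, -f r * deriv (deriv f) r + deriv f r ^ 2 = β ^ 2) :
    √K * (rS - rN) = Real.pi := by
  have hk := Real.sqrt_pos.2 hf.curvature_pos
  have hb : 0 < |β| := abs_pos.2 (hf.beta_ne_zero hβ)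
  have hlt := hf.lt
  rcases lt_trichotomy (√K * (rS - rN)) Real.pi with hlt' | heq | hgt
  · have h1 := (hf.eq_sin hβ (r := rS) ⟨hlt.le, le_rfl⟩).1
    have h2 := Real.sin_pos_of_pos_of_lt_pi (mul_pos hk (sub_pos.2 hlt)) hlt'
    rw [hf.south, mul_zero] at h1
    exact absurd h1 (mul_pos hb h2).ne
  · exact heq
  · have hm : rN + Real.pi / √K ∈ Set.Ioo rN rS := by
      refine ⟨by linarith [div_pos Real.pi_pos hk], ?_⟩
      have := (div_lt_iff₀ hk).2 (by linarith : Real.pi < (rS - rN) * √K)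
      linarith
    have h1 := (hf.eq_sin hβ (Set.Ioo_subset_Icc_self hm)).1
    have h2 : √K * (rN + Real.pi / √K - rN) = Real.pi := by field_simp; ring
    rw [h2, Real.sin_pi, mul_zero] at h1
    exact absurd h1 (mul_pos hk (hf.pos _ hm)).ne'

theorem IsSphericalRadius.deriv_south_neg (hf : IsSphericalRadius f rN rS K)
    (hβ : ∀ r ∈ Set.Icc rN rS, -f r * deriv (deriv f) r + deriv f r ^ 2 = β ^ 2) :
    deriv f rS < 0 := by
  rw [(hf.eq_sin hβ (r := rS) ⟨hf.lt.le, le_rfl⟩).2, hf.sqrt_mul_sub hβ]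
  simpa using hf.beta_ne_zero hβ

/-- The part of phase space over the open northern hemisphere, without the pole. -/
def northern (f : ℝ → ℝ) (rN rS : ℝ) : Set Phase :=
  {x | rN < x.1 ∧ x.1 < rS ∧ 0 < deriv f x.1}

theorem isOpen_northern (hf : IsSphericalRadius f rN rS K) : IsOpen (northern f rN rS) := by
  have h1 : Continuous fun x : Phase => deriv f x.1 :=
    hf.contDiff_deriv.continuous.comp continuous_fst
  exact (isOpen_lt continuous_const continuous_fst).inter
    ((isOpen_lt continuous_fst continuous_const).inter (isOpen_lt continuous_const h1))

theorem mem_energyManifold_iff {x : Phase} (hr : x.1 ∈ Set.Icc rN rS) (hd : 0 < deriv f x.1) :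
    x ∈ energyManifold f β rN rS γ h ↔
      ‖x.2.2.1‖ = 1 ∧ x.2.2.2 ^ 2 + x.2.1 ^ 2 = 2 * γ + 2 * h * β ^ 2 * (f x.1 / deriv f x.1) := by
  simp only [energyManifold, Set.mem_ofPred_eq, hr, true_and, sgnTheta, invTheta,
    Real.sign_of_pos hd, ne_eq, hd.ne', not_false_eq_true]
  refine and_congr_right fun _ => ?_
  have e : h * (-(β ^ 2 * f x.1) / deriv f x.1) = -(h * β ^ 2 * (f x.1 / deriv f x.1)) := by ring
  rw [e]
  constructor <;> intro h' <;> linarith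

theorem field_eq {x : Phase} (hd : 0 < deriv f x.1) :
    field f β γ x = (x.2.1 * f x.1,
      x.2.2.2 ^ 2 * deriv f x.1 + x.2.1 ^ 2 / 2 * (β ^ 2 / deriv f x.1) - γ * (β ^ 2 / deriv f x.1),
      Complex.I * (x.2.2.2 : ℂ) * x.2.2.1,
      -(x.2.2.2 * x.2.1) * (deriv f x.1 - β ^ 2 / deriv f x.1 / 2)) := by
  have h1 : invFTheta f β x.1 = -(β ^ 2 / deriv f x.1) := by unfold invFTheta; ring
  have h2 : |-(β ^ 2 / deriv f x.1)| = β ^ 2 / deriv f x.1 := by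
    rw [abs_neg, abs_of_nonneg (by positivity)]
  simp only [field, h1, h2, Prod.mk.injEq, true_and]
  constructor <;> ring

theorem contDiffOn_field (hf : IsSphericalRadius f rN rS K) (hβ0 : β ≠ 0) :
    ContDiffOn ℝ ∞ (field f β γ) {x : Phase | deriv f x.1 ≠ 0} := by
  intro x hx
  refine ContDiffAt.contDiffWithinAt ?_
  have h1 : ContDiffAt ℝ ∞ (fun x : Phase => x.1) x := contDiff_fst.contDiffAt
  have h2 : ContDiffAt ℝ ∞ (fun x : Phase => x.2.1) x :=
    (contDiff_fst.comp contDiff_snd).contDiffAt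
  have h3 : ContDiffAt ℝ ∞ (fun x : Phase => x.2.2.1) x :=
    (contDiff_fst.comp (contDiff_snd.comp contDiff_snd)).contDiffAt
  have h4 : ContDiffAt ℝ ∞ (fun x : Phase => x.2.2.2) x :=
    (contDiff_snd.comp (contDiff_snd.comp contDiff_snd)).contDiffAt
  have hff : ContDiffAt ℝ ∞ (fun x : Phase => f x.1) x := hf.smooth.contDiffAt.comp x h1
  have hd : ContDiffAt ℝ ∞ (fun x : Phase => deriv f x.1) x :=
    hf.contDiff_deriv.contDiffAt.comp x h1
  have hi : ContDiffAt ℝ ∞ (fun x : Phase => invFTheta f β x.1) x :=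
    contDiffAt_const.div hd hx
  have hi0 : invFTheta f β x.1 ≠ 0 := div_ne_zero (neg_ne_zero.2 (pow_ne_zero 2 hβ0)) hx
  have ha : ContDiffAt ℝ ∞ (fun x : Phase => |invFTheta f β x.1|) x :=
    hi.abs hi0
  have hc : ContDiffAt ℝ ∞ (fun x : Phase => (x.2.2.2 : ℂ)) x :=
    Complex.ofRealCLM.contDiff.contDiffAt.comp x h4
  exact (h2.mul hff).prodMk (((((h4.pow 2).mul hd).sub (((h2.pow 2).div_const 2).mul hi)).sub
    (contDiffAt_const.mul ha)).prodMk (((contDiffAt_const.mul hc).mul h3).prodMk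
    ((h4.mul h2).neg.mul (hd.add (hi.div_const 2)))))

theorem hasDerivAt_components {c : ℝ → Phase} {s : ℝ} (hd : 0 < deriv f (c s).1)
    (hc : HasDerivAt c (field f β γ (c s)) s) :
    HasDerivAt (fun s => (c s).1) ((c s).2.1 * f (c s).1) s ∧
    HasDerivAt (fun s => (c s).2.1) ((c s).2.2.2 ^ 2 * deriv f (c s).1 +
      (c s).2.1 ^ 2 / 2 * (β ^ 2 / deriv f (c s).1) - γ * (β ^ 2 / deriv f (c s).1)) s ∧
    HasDerivAt (fun s => (c s).2.2.1) (Complex.I * ((c s).2.2.2 : ℂ) * (c s).2.2.1) s ∧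
    HasDerivAt (fun s => (c s).2.2.2) (-((c s).2.2.2 * (c s).2.1) *
      (deriv f (c s).1 - β ^ 2 / deriv f (c s).1 / 2)) s := by
  rw [field_eq hd] at hc
  have h1 := hc.hasFDerivAt
  exact ⟨by simpa using! h1.fst.hasDerivAt, by simpa using! h1.snd.fst.hasDerivAt,
    by simpa using! h1.snd.snd.fst.hasDerivAt, by simpa using! h1.snd.snd.snd.hasDerivAt⟩

theorem mem_energyManifold_of_solution (hf : IsSphericalRadius f rN rS K)
    (hβ : ∀ r ∈ Set.Icc rN rS, -f r * deriv (deriv f) r + deriv f r ^ 2 = β ^ 2)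
    {a b : ℝ} {c : ℝ → Phase} (hc : Conley.IsSolutionOn (northern f rN rS) (field f β γ) a b c)
    {s₀ : ℝ} (hs₀ : s₀ ∈ Set.Ioo a b) (h0 : c s₀ ∈ energyManifold f β rN rS γ h) :
    ∀ s ∈ Set.Ioo a b, c s ∈ energyManifold f β rN rS γ h := by
  have hI : ∀ s ∈ Set.Ioo a b, (c s).1 ∈ Set.Icc rN rS := fun s hs =>
    ⟨(hc s hs).1.1.le, (hc s hs).1.2.1.le⟩
  have hcont : ∀ s ∈ Set.Ioo a b, ContinuousAt c s := fun s hs => (hc s hs).2.continuousAt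
  rw [mem_energyManifold_iff (hI s₀ hs₀) (hc s₀ hs₀).1.2.2] at h0
  have hE := eq_zero_of_linear (a := a) (b := b) (s₀ := s₀)
    (y := fun s => (c s).2.2.2 ^ 2 + (c s).2.1 ^ 2 - 2 * γ -
      2 * h * β ^ 2 * (f (c s).1 / deriv f (c s).1))
    (κ := fun s => (c s).2.1 * β ^ 2 / deriv f (c s).1)
    (fun s hs => by
      refine ContinuousAt.continuousWithinAt ?_
      have h1 := hcont s hs
      have h2 : ContinuousAt (fun s => deriv f (c s).1) s :=
        (hf.contDiff_deriv.continuous.continuousAt.comp h1.fst :)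
      exact (h1.snd.fst.mul continuousAt_const).div h2 (hc s hs).1.2.2.ne')
    (fun s hs => by
      have hd := (hc s hs).1.2.2
      obtain ⟨h1, h2, -, h4⟩ := hasDerivAt_components hd (hc s hs).2
      have h5 := (hf.hasDerivAt (c s).1).comp s h1
      have h6 := (hf.hasDerivAt_deriv (c s).1).comp s h1
      have h7 := (((h4.pow 2).add (h2.pow 2)).sub_const (2 * γ)).sub
        ((h5.div h6 hd.ne').const_mul (2 * h * β ^ 2))
      refine h7.congr_deriv ?_
      have hb := hβ _ (hI s hs)
      simp only [Function.comp_apply]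
      field_simp
      linear_combination (-4 * (c s).2.1 * β ^ 2 * h * f (c s).1) * hb)
    hs₀ (by linarith [h0.2])
  have hZ := eq_zero_of_linear (a := a) (b := b) (s₀ := s₀)
    (y := fun s => ‖(c s).2.2.1‖ ^ 2 - 1) (κ := fun _ => 0) continuousOn_const
    (fun s hs => by
      obtain ⟨-, -, h3, -⟩ := hasDerivAt_components (hc s hs).1.2.2 (hc s hs).2
      refine (h3.norm_sq.sub_const 1).congr_deriv ?_
      rw [Complex.inner]
      simp [Complex.mul_re, Complex.mul_im]
      ring) hs₀ (by simp [h0.1])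
  intro s hs
  rw [mem_energyManifold_iff (hI s hs) (hc s hs).1.2.2]
  refine ⟨?_, by linarith [hE s hs]⟩
  have := hZ s hs
  have h1 : ‖(c s).2.2.1‖ ^ 2 = 1 := by linarith
  exact (pow_eq_one_iff_of_nonneg (norm_nonneg _) two_ne_zero).1 h1

theorem mem_northern_of_solution (hf : IsSphericalRadius f rN rS K)
    (hβ : ∀ r ∈ Set.Icc rN rS, -f r * deriv (deriv f) r + deriv f r ^ 2 = β ^ 2)
    {a b : ℝ} {c : ℝ → Phase}
    (hc : Conley.IsSolutionOn (energyManifold f β rN rS γ h) (field f β γ) a b c) {s₀ : ℝ}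
    (hs₀ : s₀ ∈ Set.Ioo a b) (h0 : c s₀ ∈ northern f rN rS) :
    ∀ s ∈ Set.Ioo a b, c s ∈ northern f rN rS := by
  have hcont : ∀ s ∈ Set.Ioo a b, ContinuousAt c s := fun s hs => (hc s hs).2.continuousAt
  have hdc : ContinuousOn (fun s => deriv f (c s).1) (Set.Ioo a b) := fun s hs =>
    (hf.contDiff_deriv.continuous.continuousAt.comp (hcont s hs).fst :).continuousWithinAt
  have hpos : ∀ s ∈ Set.Ioo a b, 0 < deriv f (c s).1 := by
    intro s hs
    by_contra! hneg
    obtain ⟨t, ht, ht0⟩ := isPreconnected_Ioo.intermediate_value hs hs₀ hdc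
      ⟨hneg, h0.2.2.le⟩
    exact (hc t ht).1.2.2.1 ht0
  intro s hs
  refine ⟨lt_of_le_of_ne (hc s hs).1.1.1 fun he => ?_, lt_of_le_of_ne (hc s hs).1.1.2 fun he => ?_,
    hpos s hs⟩
  · have hz := eq_zero_of_linear (a := a) (b := b) (s₀ := s) (y := fun s => f (c s).1)
      (κ := fun s => deriv f (c s).1 * (c s).2.1)
      (hdc.mul fun t ht => (hcont t ht).snd.fst.continuousWithinAt)
      (fun t ht => by
        obtain ⟨h1, -⟩ := hasDerivAt_components (hpos t ht) (hc t ht).2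
        exact ((hf.hasDerivAt (c t).1).comp t h1).congr_deriv (by ring)) hs
      (by simp [← he, hf.north]) s₀ hs₀
    exact (hf.pos _ ⟨h0.1, h0.2.1⟩).ne' hz
  · have := hpos s hs
    rw [he] at this
    exact this.not_gt (hf.deriv_south_neg hβ)

theorem isRegularFlow (hf : IsSphericalRadius f rN rS K)
    (hβ : ∀ r ∈ Set.Icc rN rS, -f r * deriv (deriv f) r + deriv f r ^ 2 = β ^ 2) :
    Conley.IsRegularFlow (energyManifold f β rN rS γ h) (field f β γ) (northern f rN rS) := by
  have hU : IsOpen {x : Phase | deriv f x.1 ≠ 0} :=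
    isOpen_ne_fun (hf.contDiff_deriv.continuous.comp continuous_fst) continuous_const
  have hF := contDiffOn_field (γ := γ) hf (hf.beta_ne_zero hβ)
  have hMU : ∀ {a b : ℝ} {c : ℝ → Phase},
      Conley.IsSolutionOn (energyManifold f β rN rS γ h) (field f β γ) a b c →
      Conley.IsSolutionOn {x : Phase | deriv f x.1 ≠ 0} (field f β γ) a b c := fun hc s hs =>
    ⟨(hc s hs).1.2.2.1, (hc s hs).2⟩
  refine ⟨fun h₁ h₂ hs he => (hMU h₁).eqOn hU hF (hMU h₂) hs he, isOpen_northern hf,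
    fun {x} hx => ?_, fun hc hs h0 => mem_northern_of_solution hf hβ hc hs h0, ?_⟩
  · exact hF.continuousOn.continuousAt (hU.mem_nhds hx.2.2.ne')
  · intro a b c a' b' ε hc h0 ha' hb' hε
    have hI0 : (0 : ℝ) ∈ Set.Ioo a b := ⟨ha'.1.trans ha'.2, hb'.1.trans hb'.2⟩
    have hsub : Set.Icc a' b' ⊆ Set.Ioo a b := Set.Icc_subset_Ioo ha'.1 hb'.2
    obtain ⟨η, hη, hηW⟩ := (isCompact_Icc.image_of_continuousOn
      (hc.continuousOn.mono hsub)).exists_thickening_subset_open (isOpen_northern hf)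
      (Set.image_subset_iff.2 fun s hs =>
        mem_northern_of_solution hf hβ hc hI0 h0 s (hsub hs))
    obtain ⟨δ, hδ, H⟩ := (hMU hc).exists_near hU hF ha' hb' (lt_min hε hη)
    refine ⟨δ, hδ, fun y hy hyd => ?_⟩
    obtain ⟨d, hd0, hd, hdc⟩ := H y hyd
    have hdW : Conley.IsSolutionOn (northern f rN rS) (field f β γ) a' b' d := fun s hs =>
      ⟨hηW (Metric.mem_thickening_iff.2 ⟨c s, ⟨s, Set.Ioo_subset_Icc_self hs, rfl⟩,
        (hdc s hs).trans_le (min_le_right _ _)⟩), (hd s hs).2⟩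
    refine ⟨d, hd0, fun s hs => ⟨?_, (hd s hs).2⟩, fun s hs =>
      (hdc s hs).trans_le (min_le_left _ _)⟩
    exact mem_energyManifold_of_solution hf hβ hdW ⟨ha'.2, hb'.1⟩ (hd0 ▸ hy) s hs

end
end Kepler

namespace Kepler

/-! ### Radial orbits -/

/-- If `ṙ` has the sign of `v`, `v` starts negative, and `v` does not vanish where `r ≤ r₁`, then `r`
stays below `r₁`. -/
theorem le_of_velocity_ne_zero {r v g : ℝ → ℝ} {b r₁ : ℝ} (hv : ContinuousOn v (Set.Ico 0 b))
    (hr : ∀ s ∈ Set.Ico 0 b, HasDerivAt r (v s * g s) s) (hg : ∀ s ∈ Set.Ico 0 b, 0 ≤ g s)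
    (hr0 : r 0 ≤ r₁) (hv0 : v 0 < 0) (hne : ∀ s ∈ Set.Ico 0 b, r s ≤ r₁ → v s ≠ 0) :
    ∀ s ∈ Set.Ico 0 b, r s ≤ r₁ := by
  have hanti : ∀ t ∈ Set.Ico 0 b, (∀ s ∈ Set.Ioo 0 t, v s ≤ 0) → r t ≤ r₁ := by
    intro t ht hneg
    have hsub : Set.Icc 0 t ⊆ Set.Ico 0 b := fun s hs => ⟨hs.1, hs.2.trans_lt ht.2⟩
    refine le_trans ?_ hr0
    refine antitoneOn_of_deriv_nonpos (convex_Icc 0 t)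
      (fun s hs => (hr s (hsub hs)).continuousAt.continuousWithinAt)
      (fun s hs => (hr s (hsub (interior_subset hs))).differentiableAt.differentiableWithinAt)
      (fun s hs => ?_) ⟨le_rfl, ht.1⟩ ⟨ht.1, le_rfl⟩ ht.1
    have hs' := hsub (interior_subset hs)
    rw [interior_Icc] at hs
    rw [(hr s hs').deriv]
    exact mul_nonpos_of_nonpos_of_nonneg (hneg s hs) (hg s hs')
  have hneg : ∀ s ∈ Set.Ico 0 b, v s < 0 := by
    intro s hs
    by_contra! hcon
    have hsub : Set.Icc 0 s ⊆ Set.Ico 0 b := fun t ht => ⟨ht.1, ht.2.trans_lt hs.2⟩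
    have hcomp : IsCompact (Set.Icc 0 s ∩ v ⁻¹' Set.Ici 0) :=
      isCompact_Icc.of_isClosed_subset ((hv.mono hsub).preimage_isClosed_of_isClosed
        isClosed_Icc isClosed_Ici) Set.inter_subset_left
    obtain ⟨t, ⟨ht, ht0⟩, hmin⟩ := hcomp.exists_isLeast ⟨s, ⟨hs.1, le_rfl⟩, hcon⟩
    have hlt : ∀ t' ∈ Set.Ioo 0 t, v t' < 0 := fun t' ht' => by
      by_contra! h
      exact (hmin ⟨⟨ht'.1.le, ht'.2.le.trans ht.2⟩, h⟩).not_gt ht'.2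
    have htr := hanti t (hsub ht) fun t' ht' => (hlt t' ht').le
    obtain ⟨t', ht', h0⟩ := isPreconnected_Icc.intermediate_value
      (⟨le_rfl, ht.1⟩ : (0 : ℝ) ∈ Set.Icc 0 t) (⟨ht.1, le_rfl⟩ : t ∈ Set.Icc 0 t)
      (hv.mono fun q hq => hsub ⟨hq.1, hq.2.trans ht.2⟩) ⟨hv0.le, ht0⟩
    have : t ≤ t' := hmin ⟨⟨ht'.1, ht'.2.trans ht.2⟩, h0.ge⟩
    exact hne t (hsub ht) htr (le_antisymm this ht'.2 ▸ h0)
  exact fun s hs => hanti s hs fun t ht => (hneg t ⟨ht.1.le, ht.2.trans hs.2⟩).le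

section
variable {f : ℝ → ℝ} {rN rS K β γ h a b r₁ : ℝ} {c : ℝ → Phase}

/-- An orbit with `u = 0` at one time is radial: `u = 0` and the angle is constant. -/
theorem radial_of_solution (hf : IsSphericalRadius f rN rS K)
    (hβ : ∀ r ∈ Set.Icc rN rS, -f r * deriv (deriv f) r + deriv f r ^ 2 = β ^ 2)
    (hc : Conley.IsSolutionOn (energyManifold f β rN rS γ h) (field f β γ) a b c)
    (h0 : (0 : ℝ) ∈ Set.Ioo a b) (h0W : c 0 ∈ northern f rN rS) (hu : (c 0).2.2.2 = 0) :
    ∀ s ∈ Set.Ioo a b, (c s).2.2.2 = 0 ∧ (c s).2.2.1 = (c 0).2.2.1 := by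
  have hW := mem_northern_of_solution hf hβ hc h0 h0W
  have hcont : ∀ s ∈ Set.Ioo a b, ContinuousAt c s := fun s hs => (hc s hs).2.continuousAt
  have hu0 := eq_zero_of_linear (y := fun s => (c s).2.2.2)
    (κ := fun s => -(c s).2.1 * (deriv f (c s).1 - β ^ 2 / deriv f (c s).1 / 2))
    (fun s hs => by
      have h1 := hcont s hs
      have h2 : ContinuousAt (fun s => deriv f (c s).1) s :=
        (hf.contDiff_deriv.continuous.continuousAt.comp h1.fst :)
      exact (h1.snd.fst.neg.mul (h2.sub ((continuousAt_const.div h2 (hW s hs).2.2.ne').div_const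
        2))).continuousWithinAt)
    (fun s hs => (hasDerivAt_components (hW s hs).2.2 (hc s hs).2).2.2.2.congr_deriv (by ring))
    h0 hu
  have hz : ∀ s ∈ Set.Ioo a b, HasDerivAt (fun s => (c s).2.2.1) 0 s := fun s hs => by
    refine (hasDerivAt_components (hW s hs).2.2 (hc s hs).2).2.2.1.congr_deriv ?_
    rw [hu0 s hs]
    simp
  exact fun s hs => ⟨hu0 s hs, isOpen_Ioo.is_const_of_deriv_eq_zero isPreconnected_Ioo
    (fun t ht => (hz t ht).differentiableAt.differentiableWithinAt)
    (fun t ht => (hz t ht).deriv) hs h0⟩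

theorem velocity_ne_zero_of_radial
    (hρ : ∀ r ∈ Set.Icc rN r₁, 0 < 2 * γ + 2 * h * β ^ 2 * (f r / deriv f r)) {x : Phase}
    (hx : x ∈ energyManifold f β rN rS γ h) (hd : 0 < deriv f x.1) (hu : x.2.2.2 = 0)
    (hr : x.1 ≤ r₁) : x.2.1 ≠ 0 := by
  have h1 := ((mem_energyManifold_iff hx.1 hd).1 hx).2
  rw [hu] at h1
  intro h2
  rw [h2] at h1
  linarith [hρ x.1 ⟨hx.1.1, hr⟩]

theorem le_of_radial_incoming (hf : IsSphericalRadius f rN rS K)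
    (hβ : ∀ r ∈ Set.Icc rN rS, -f r * deriv (deriv f) r + deriv f r ^ 2 = β ^ 2)
    (hρ : ∀ r ∈ Set.Icc rN r₁, 0 < 2 * γ + 2 * h * β ^ 2 * (f r / deriv f r))
    (hc : Conley.IsSolutionOn (energyManifold f β rN rS γ h) (field f β γ) a b c)
    (h0 : (0 : ℝ) ∈ Set.Ioo a b) (h0W : c 0 ∈ northern f rN rS) (hu : (c 0).2.2.2 = 0)
    (hr : (c 0).1 ≤ r₁) (hv : (c 0).2.1 < 0) : ∀ s ∈ Set.Ico 0 b, (c s).1 ≤ r₁ := by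
  have hW := mem_northern_of_solution hf hβ hc h0 h0W
  have hI : ∀ s ∈ Set.Ico 0 b, s ∈ Set.Ioo a b := fun s hs => ⟨h0.1.trans_le hs.1, hs.2⟩
  refine le_of_velocity_ne_zero (v := fun s => (c s).2.1) (g := fun s => f (c s).1)
    (fun s hs => (hc s (hI s hs)).2.continuousAt.snd.fst.continuousWithinAt)
    (fun s hs => (hasDerivAt_components (hW s (hI s hs)).2.2 (hc s (hI s hs)).2).1)
    (fun s hs => (hf.pos _ ⟨(hW s (hI s hs)).1, (hW s (hI s hs)).2.1⟩).le) hr hv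
    fun s hs hle => velocity_ne_zero_of_radial hρ (hc s (hI s hs)).1 (hW s (hI s hs)).2.2
      (radial_of_solution hf hβ hc h0 h0W hu s (hI s hs)).1 hle

theorem le_of_radial_outgoing (hf : IsSphericalRadius f rN rS K)
    (hβ : ∀ r ∈ Set.Icc rN rS, -f r * deriv (deriv f) r + deriv f r ^ 2 = β ^ 2)
    (hρ : ∀ r ∈ Set.Icc rN r₁, 0 < 2 * γ + 2 * h * β ^ 2 * (f r / deriv f r))
    (hc : Conley.IsSolutionOn (energyManifold f β rN rS γ h) (field f β γ) a b c)
    (h0 : (0 : ℝ) ∈ Set.Ioo a b) (h0W : c 0 ∈ northern f rN rS) (hu : (c 0).2.2.2 = 0)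
    (hr : (c 0).1 ≤ r₁) (hv : 0 < (c 0).2.1) : ∀ s ∈ Set.Ioc a 0, (c s).1 ≤ r₁ := by
  have hW := mem_northern_of_solution hf hβ hc h0 h0W
  have hI : ∀ s ∈ Set.Ico 0 (-a), -s ∈ Set.Ioo a b := fun s hs =>
    ⟨by linarith [hs.2], by linarith [hs.1, h0.2]⟩
  have key := le_of_velocity_ne_zero (r := fun s => (c (-s)).1) (v := fun s => -(c (-s)).2.1)
    (g := fun s => f (c (-s)).1) (b := -a) (r₁ := r₁)
    (fun s hs => ((hc _ (hI s hs)).2.continuousAt.snd.fst.comp (x := s) (f := fun s => -s)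
      continuousAt_neg).neg.continuousWithinAt)
    (fun s hs => by
      have h1 := (hasDerivAt_components (hW _ (hI s hs)).2.2 (hc _ (hI s hs)).2).1
      have h2 := h1.comp s (hasDerivAt_neg s)
      exact h2.congr_deriv (by ring))
    (fun s hs => (hf.pos _ ⟨(hW _ (hI s hs)).1, (hW _ (hI s hs)).2.1⟩).le) (by simpa using hr)
    (by simpa using hv)
    fun s hs hle => neg_ne_zero.2 (velocity_ne_zero_of_radial hρ (hc _ (hI s hs)).1
      (hW _ (hI s hs)).2.2 (radial_of_solution hf hβ hc h0 h0W hu _ (hI s hs)).1 hle)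
  intro s hs
  simpa using key (-s) ⟨by linarith [hs.2], by linarith [hs.1]⟩

end

/-! ### The Kepler orbits -/

/-- A scalar equation with a continuous right-hand side between two positive bounds has a solution
which passes from any value to any larger one. -/
theorem exists_scalar_solution {g : ℝ → ℝ} (hg : Continuous g) {m C : ℝ} (hm : 0 < m)
    (hmg : ∀ x, m ≤ g x) (hgC : ∀ x, g x ≤ C) {x₀ x₁ : ℝ} (hlt : x₀ < x₁) :
    ∃ φ : ℝ → ℝ, StrictMono φ ∧ φ 0 = x₀ ∧ (∀ t, HasDerivAt φ (g (φ t)) t) ∧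
      ∃ S > 0, φ S = x₁ := by
  have hpos : ∀ x, 0 < g x := fun x => hm.trans_le (hmg x)
  have hC : 0 < C := (hpos 0).trans_le (hgC 0)
  have hinv : Continuous fun x => (g x)⁻¹ := hg.inv₀ fun x => (hpos x).ne'
  let T : ℝ → ℝ := fun x => ∫ y in x₀..x, (g y)⁻¹
  have hT : ∀ x, HasDerivAt T (g x)⁻¹ x := fun x =>
    intervalIntegral.integral_hasDerivAt_right (hinv.intervalIntegrable _ _)
      (hinv.stronglyMeasurableAtFilter _ _) hinv.continuousAt
  have hmono : StrictMono T := strictMono_of_deriv_pos fun x => by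
    rw [(hT x).deriv]
    exact inv_pos.2 (hpos x)
  have hmono' : Monotone fun x => T x - C⁻¹ * x := by
    have hd : ∀ x, HasDerivAt (fun x => T x - C⁻¹ * x) ((g x)⁻¹ - C⁻¹) x := fun x => by
      simpa using! (hT x).sub ((hasDerivAt_id x).const_mul C⁻¹)
    refine monotone_of_deriv_nonneg (fun x => (hd x).differentiableAt) fun x => ?_
    rw [(hd x).deriv, sub_nonneg]
    exact inv_anti₀ (hpos x) (hgC x)
  have htop : Filter.Tendsto T Filter.atTop Filter.atTop := by
    refine Filter.tendsto_atTop_mono' (f₁ := fun x => C⁻¹ * x + T 0) _ ?_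
      (Filter.tendsto_atTop_add_const_right _ _
        (Filter.tendsto_id.const_mul_atTop (inv_pos.2 hC)))
    filter_upwards [Filter.eventually_ge_atTop 0] with x hx
    have := hmono' hx
    simp only [mul_zero, sub_zero] at this
    linarith
  have hbot : Filter.Tendsto T Filter.atBot Filter.atBot := by
    refine Filter.tendsto_atBot_mono' (f₁ := fun x => C⁻¹ * x + T 0) _ ?_
      (Filter.tendsto_atBot_add_const_right _ _
        (Filter.tendsto_id.const_mul_atBot (inv_pos.2 hC)))
    filter_upwards [Filter.eventually_le_atBot 0] with x hx
    have := hmono' hx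
    simp only [mul_zero, sub_zero] at this
    linarith
  have hTc : Continuous T := continuous_iff_continuousAt.2 fun x => (hT x).continuousAt
  let e := hmono.orderIsoOfSurjective T (hTc.surjective htop hbot)
  have heT : ∀ x, e x = T x := fun x => rfl
  have hsymm : ∀ x, e.symm (T x) = x := fun x => e.symm_apply_apply x
  have hT0 : T x₀ = 0 := intervalIntegral.integral_same
  refine ⟨e.symm, e.symm.strictMono, by rw [← hT0, hsymm], fun t => ?_, T x₁, ?_, hsymm x₁⟩
  · have := HasDerivAt.of_local_left_inverse (f := T) (g := e.symm) (a := t)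
      e.symm.continuous.continuousAt (hT _) (inv_ne_zero (hpos _).ne')
      (Filter.Eventually.of_forall fun y => e.apply_symm_apply y)
    rwa [inv_inv] at this
  · rw [← hT0]
    exact hmono hlt

/-- The inverse function of `-Θ` on the open northern hemisphere. -/
noncomputable def radius (rN K β w : ℝ) : ℝ := rN + Real.arctan (√K / (β ^ 2 * w)) / √K

section
variable {f : ℝ → ℝ} {rN rS K β γ h : ℝ}

theorem radius_mem_Ioo (hf : IsSphericalRadius f rN rS K)
    (hβ : ∀ r ∈ Set.Icc rN rS, -f r * deriv (deriv f) r + deriv f r ^ 2 = β ^ 2) {w : ℝ}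
    (hw : 0 < w) : radius rN K β w ∈ Set.Ioo rN rS := by
  have hk := Real.sqrt_pos.2 hf.curvature_pos
  have hb : 0 < β ^ 2 := by have := hf.beta_ne_zero hβ; positivity
  have h1 : 0 < Real.arctan (√K / (β ^ 2 * w)) := Real.arctan_pos.2 (by positivity)
  have h2 := Real.arctan_lt_pi_div_two (√K / (β ^ 2 * w))
  have h3 := hf.sqrt_mul_sub hβ
  refine ⟨by unfold radius; linarith [div_pos h1 hk], ?_⟩
  have : Real.arctan (√K / (β ^ 2 * w)) / √K < rS - rN := by
    rw [div_lt_iff₀ hk]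
    linarith [Real.pi_pos]
  unfold radius
  linarith

theorem deriv_radius (hf : IsSphericalRadius f rN rS K)
    (hβ : ∀ r ∈ Set.Icc rN rS, -f r * deriv (deriv f) r + deriv f r ^ 2 = β ^ 2) {w : ℝ}
    (hw : 0 < w) : deriv f (radius rN K β w) = β ^ 2 * w * f (radius rN K β w) := by
  have hk := Real.sqrt_pos.2 hf.curvature_pos
  have hb : 0 < β ^ 2 := by have := hf.beta_ne_zero hβ; positivity
  obtain ⟨h1, h2⟩ := hf.eq_sin hβ (Set.Ioo_subset_Icc_self (radius_mem_Ioo hf hβ hw))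
  have h3 : √K * (radius rN K β w - rN) = Real.arctan (√K / (β ^ 2 * w)) := by
    unfold radius; field_simp; ring
  rw [h3] at h1 h2
  have h4 := Real.tan_arctan (√K / (β ^ 2 * w))
  rw [Real.tan_eq_sin_div_cos, div_eq_iff (Real.cos_arctan_pos _).ne'] at h4
  rw [h4] at h1
  rw [h2]
  have h5 : f (radius rN K β w) = |β| * (1 / (β ^ 2 * w) *
      Real.cos (Real.arctan (√K / (β ^ 2 * w)))) := by
    refine mul_left_cancel₀ hk.ne' (h1.trans ?_)
    ring
  have hb0 := hf.beta_ne_zero hβ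
  rw [h5]
  field_simp

theorem radius_sq (hf : IsSphericalRadius f rN rS K)
    (hβ : ∀ r ∈ Set.Icc rN rS, -f r * deriv (deriv f) r + deriv f r ^ 2 = β ^ 2) {w : ℝ}
    (hw : 0 < w) : f (radius rN K β w) ^ 2 * (β ^ 4 * w ^ 2 + K) = β ^ 2 := by
  have hI := Set.Ioo_subset_Icc_self (radius_mem_Ioo hf hβ hw)
  have h1 := hβ _ hI
  rw [hf.curvature _ hI, deriv_radius hf hβ hw] at h1
  linear_combination h1

theorem hasDerivAt_radius (hf : IsSphericalRadius f rN rS K)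
    (hβ : ∀ r ∈ Set.Icc rN rS, -f r * deriv (deriv f) r + deriv f r ^ 2 = β ^ 2) {w : ℝ}
    (hw : 0 < w) : HasDerivAt (radius rN K β) (-f (radius rN K β w) ^ 2) w := by
  have hk := Real.sqrt_pos.2 hf.curvature_pos
  have hk2 : √K ^ 2 = K := Real.sq_sqrt hf.curvature_pos.le
  have hb : β ≠ 0 := hf.beta_ne_zero hβ
  have h1 : HasDerivAt (fun w => √K / (β ^ 2 * w)) (-√K * β ^ 2 / (β ^ 2 * w) ^ 2) w := by
    have h2 : HasDerivAt (fun w => β ^ 2 * w) (β ^ 2) w := by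
      simpa using (hasDerivAt_id w).const_mul (β ^ 2)
    exact ((hasDerivAt_const w √K).div h2 (by positivity)).congr_deriv (by ring)
  refine ((h1.arctan.div_const √K).const_add rN).congr_deriv ?_
  have h3 := radius_sq hf hβ hw
  have hK := hf.curvature_pos
  have h4 : f (radius rN K β w) ^ 2 = β ^ 2 / (β ^ 4 * w ^ 2 + K) := by
    rw [eq_div_iff (by positivity)]; exact h3
  rw [h4, div_pow, hk2]
  field_simp

theorem radius_eq (hf : IsSphericalRadius f rN rS K)
    (hβ : ∀ r ∈ Set.Icc rN rS, -f r * deriv (deriv f) r + deriv f r ^ 2 = β ^ 2) {r : ℝ}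
    (hr : r ∈ Set.Ioo rN rS) (hd : 0 < deriv f r) :
    radius rN K β (deriv f r / (β ^ 2 * f r)) = r := by
  have hk := Real.sqrt_pos.2 hf.curvature_pos
  have hb : β ≠ 0 := hf.beta_ne_zero hβ
  have hfr := hf.pos r hr
  obtain ⟨h1, h2⟩ := hf.eq_sin hβ (Set.Ioo_subset_Icc_self hr)
  have hs : 0 < √K * (r - rN) := mul_pos hk (sub_pos.2 hr.1)
  have hlt : √K * (r - rN) < Real.pi / 2 := by
    by_contra! hcon
    have h3 : √K * (r - rN) ≤ Real.pi := by
      rw [← hf.sqrt_mul_sub hβ]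
      have := hr.2.le
      gcongr
    have h4 := Real.cos_nonpos_of_pi_div_two_le_of_le hcon (by linarith [Real.pi_pos])
    rw [h2] at hd
    exact hd.not_ge (mul_nonpos_of_nonneg_of_nonpos (abs_nonneg _) h4)
  have h5 : √K / (β ^ 2 * (deriv f r / (β ^ 2 * f r))) = Real.tan (√K * (r - rN)) := by
    have hc : Real.cos (√K * (r - rN)) ≠ 0 := fun h => by rw [h2, h, mul_zero] at hd; exact hd.ne rfl
    have hb' : |β| ≠ 0 := abs_ne_zero.2 hb
    have h6 : √K / (β ^ 2 * (deriv f r / (β ^ 2 * f r))) = √K * f r / deriv f r := by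
      field_simp
    rw [h6, h1, h2, Real.tan_eq_sin_div_cos, mul_div_mul_left _ _ hb']
  unfold radius
  rw [h5, Real.arctan_tan (by linarith [Real.pi_pos]) hlt]
  field_simp
  linarith

theorem radius_le_of_le (hf : IsSphericalRadius f rN rS K) (hb : β ≠ 0) {w₁ w : ℝ} (hw₁ : 0 < w₁)
    (hw : w₁ ≤ w) : radius rN K β w ≤ radius rN K β w₁ := by
  have hk := Real.sqrt_pos.2 hf.curvature_pos
  unfold radius
  gcongr

end

/-- The value of `-Θ` on the Kepler orbit with angular momentum `J` at the phase `φ`, the angle from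
the pericentre multiplied by `|β|`. -/
noncomputable def conic (β γ J R φ : ℝ) : ℝ := (γ + R * Real.cos φ) / (β ^ 2 * J ^ 2)

/-- The point at the phase `φ` of the Kepler orbit with angular momentum `σJ`, where `σ = ±1`, which
has the angle `z₀` at the phase `-φ₁`. -/
noncomputable def orbit (f : ℝ → ℝ) (rN K β γ J R σ φ₁ : ℝ) (z₀ : ℂ) (φ : ℝ) : Phase :=
  (radius rN K β (conic β γ J R φ), R * Real.sin φ / (|β| * J * √(conic β γ J R φ)),
    z₀ * Complex.exp ((σ * (φ + φ₁) / |β| : ℝ) * Complex.I),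
    σ * (J / (f (radius rN K β (conic β γ J R φ)) * √(conic β γ J R φ))))

section
variable {f : ℝ → ℝ} {rN rS K β γ h J R σ φ₁ : ℝ} {z₀ : ℂ}

theorem orbit_mem (hf : IsSphericalRadius f rN rS K)
    (hβ : ∀ r ∈ Set.Icc rN rS, -f r * deriv (deriv f) r + deriv f r ^ 2 = β ^ 2)
    (hJ : 0 < J) (hR : R ^ 2 = γ ^ 2 + 2 * h * β ^ 2 * J ^ 2 - J ^ 4 * K) (hσ : σ ^ 2 = 1)
    (hz₀ : ‖z₀‖ = 1) {φ : ℝ} (hw : 0 < conic β γ J R φ) :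
    orbit f rN K β γ J R σ φ₁ z₀ φ ∈ energyManifold f β rN rS γ h := by
  have hb : β ≠ 0 := hf.beta_ne_zero hβ
  have hI := radius_mem_Ioo hf hβ hw
  have hfp := hf.pos _ hI
  have hd := deriv_radius hf hβ hw
  have hsq := radius_sq hf hβ hw
  have hd0 : 0 < deriv f (radius rN K β (conic β γ J R φ)) := by rw [hd]; positivity
  rw [mem_energyManifold_iff (x := orbit f rN K β γ J R σ φ₁ z₀ φ) (Set.Ioo_subset_Icc_self hI) hd0]
  have hwdef : β ^ 2 * J ^ 2 * conic β γ J R φ = γ + R * Real.cos φ := by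
    unfold conic; field_simp
  simp only [orbit, norm_mul, Complex.norm_exp_ofReal_mul_I, hz₀, mul_one, true_and, hd]
  set w := conic β γ J R φ
  set F := f (radius rN K β w)
  have hws : √w ^ 2 = w := Real.sq_sqrt hw.le
  have hb2 : |β| ^ 2 = β ^ 2 := sq_abs β
  have hsc := Real.sin_sq_add_cos_sq φ
  have e1 : (σ * (J / (F * √w))) ^ 2 = J ^ 2 * (β ^ 4 * w ^ 2 + K) / (β ^ 2 * w) := by
    rw [mul_pow, hσ, one_mul, div_pow, mul_pow, hws, div_eq_div_iff (by positivity) (by positivity)]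
    linear_combination -J ^ 2 * w * hsq
  have e2 : (R * Real.sin φ / (|β| * J * √w)) ^ 2 =
      (R ^ 2 * Real.sin φ ^ 2) / (β ^ 2 * J ^ 2 * w) := by
    rw [div_pow, mul_pow, mul_pow, mul_pow, hws, hb2]
  rw [e1, e2]
  have e3 : (γ + R * Real.cos φ - γ) ^ 2 + R ^ 2 * Real.sin φ ^ 2 = R ^ 2 := by
    linear_combination R ^ 2 * hsc
  rw [← hwdef] at e3
  field_simp
  linear_combination e3 + hR

theorem hasDerivAt_orbit (hf : IsSphericalRadius f rN rS K)
    (hβ : ∀ r ∈ Set.Icc rN rS, -f r * deriv (deriv f) r + deriv f r ^ 2 = β ^ 2)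
    (hJ : 0 < J) (hσ : σ ^ 2 = 1) {φ : ℝ → ℝ} {t : ℝ} (hw : 0 < conic β γ J R (φ t))
    (hφ : HasDerivAt φ (|β| * (J / (f (radius rN K β (conic β γ J R (φ t))) *
      √(conic β γ J R (φ t))))) t) :
    HasDerivAt (fun t => orbit f rN K β γ J R σ φ₁ z₀ (φ t))
      (field f β γ (orbit f rN K β γ J R σ φ₁ z₀ (φ t))) t := by
  have hb : β ≠ 0 := hf.beta_ne_zero hβ
  have hb1 : |β| ≠ 0 := abs_ne_zero.2 hb
  have hb2 : |β| ^ 2 = β ^ 2 := sq_abs β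
  have hI := radius_mem_Ioo hf hβ hw
  have hfp := hf.pos _ hI
  have hd := deriv_radius hf hβ hw
  have hd0 : 0 < deriv f (radius rN K β (conic β γ J R (φ t))) := by rw [hd]; positivity
  rw [field_eq (x := orbit f rN K β γ J R σ φ₁ z₀ (φ t)) hd0]
  have hwdef : β ^ 2 * J ^ 2 * conic β γ J R (φ t) = γ + R * Real.cos (φ t) := by
    unfold conic; field_simp
  have hws : √(conic β γ J R (φ t)) ^ 2 = conic β γ J R (φ t) := Real.sq_sqrt hw.le
  have hsp : 0 < √(conic β γ J R (φ t)) := Real.sqrt_pos.2 hw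
  -- the derivatives of `w = -Θ`, `√w`, `r` and `f(r)` along the orbit
  have dw : HasDerivAt (fun t => conic β γ J R (φ t))
      (-(R * Real.sin (φ t) / (|β| * J * √(conic β γ J R (φ t)))) /
        f (radius rN K β (conic β γ J R (φ t)))) t := by
    refine (((hφ.cos.const_mul R).const_add γ).div_const (β ^ 2 * J ^ 2)).congr_deriv ?_
    rw [← hb2]
    field_simp
  have dr := (hasDerivAt_radius hf hβ hw).comp t dw
  have ds := dw.sqrt hw.ne'
  have df := (hf.hasDerivAt _).comp t dr
  have du := (((hasDerivAt_const t J).div (df.mul ds)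
    (mul_pos hfp hsp).ne').const_mul σ)
  have dv := (hφ.sin.const_mul R).div (ds.const_mul (|β| * J))
    (mul_ne_zero (mul_ne_zero hb1 hJ.ne') hsp.ne')
  have dθ : HasDerivAt (fun t => σ * (φ t + φ₁) / |β|) (σ * (J /
      (f (radius rN K β (conic β γ J R (φ t))) * √(conic β γ J R (φ t))))) t := by
    refine (((hφ.add_const φ₁).const_mul σ).div_const |β|).congr_deriv ?_
    field_simp
  have dz := ((dθ.ofReal_comp.mul_const Complex.I).cexp.const_mul z₀)
  refine (dr.prodMk (dv.prodMk (dz.prodMk du))).congr_deriv ?_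
  simp only [orbit, Function.comp_apply, hd, Prod.mk.injEq, Pi.mul_apply]
  generalize conic β γ J R (φ t) = w at *
  generalize f (radius rN K β w) = F at *
  generalize √w = W at *
  generalize Real.cos (φ t) = C at *
  generalize Real.sin (φ t) = D at *
  subst hws
  refine ⟨?_, ?_, ?_, ?_⟩
  · field_simp
  · rw [mul_pow σ, hσ]
    have hC : R * C = β ^ 2 * J ^ 2 * W ^ 2 - γ := by linarith
    field_simp
    linear_combination (2 * |β| ^ 2 * J ^ 2 * W ^ 2) * hC
  · push_cast; ring
  · field_simp
    ring

end
end Kepler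

namespace Kepler

/-! ### The passage near the collision manifold -/

section
variable {f : ℝ → ℝ} {rN rS K β γ h J R σ φ₁ r₁ : ℝ} {z₀ : ℂ}

/-- The orbit segment of phases in `[-φ₁, φ₁]` is traversed in finite time, and remains in `r ≤ r₁` if
its ends lie on `r = r₁`. -/
theorem exists_flowsTo_orbit (hf : IsSphericalRadius f rN rS K)
    (hβ : ∀ r ∈ Set.Icc rN rS, -f r * deriv (deriv f) r + deriv f r ^ 2 = β ^ 2)
    (hJ : 0 < J) (hR0 : 0 < R) (hR : R ^ 2 = γ ^ 2 + 2 * h * β ^ 2 * J ^ 2 - J ^ 4 * K)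
    (hσ : σ ^ 2 = 1) (hz₀ : ‖z₀‖ = 1) (hφ₁ : φ₁ ∈ Set.Ioo 0 Real.pi)
    (hw₁ : 0 < conic β γ J R φ₁) (hr₁ : radius rN K β (conic β γ J R φ₁) = r₁) :
    ∃ x y : energyManifold f β rN rS γ h, (x : Phase) = orbit f rN K β γ J R σ φ₁ z₀ (-φ₁) ∧
      (y : Phase) = orbit f rN K β γ J R σ φ₁ z₀ φ₁ ∧ ∃ S > 0,
      Conley.FlowsTo (energyManifold f β rN rS γ h) (field f β γ) x S y ∧ ∀ s ∈ Set.Icc 0 S, ∀ z,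
        Conley.FlowsTo (energyManifold f β rN rS γ h) (field f β γ) x s z → (z : Phase).1 ≤ r₁ := by
  have hb : β ≠ 0 := hf.beta_ne_zero hβ
  have hb1 : 0 < |β| := abs_pos.2 hb
  set w₁ := conic β γ J R φ₁ with hw₁def
  have hwc : Continuous (conic β γ J R) := by
    unfold conic; fun_prop
  -- the speed of the phase, cut off where `w` is small so that it is bounded and defined for all phases
  let G : ℝ → ℝ := fun w => |β| * (J / (f (radius rN K β w) * √w))
  let g : ℝ → ℝ := fun φ => G (max (conic β γ J R φ) (w₁ / 2))
  have hGpos : ∀ w, 0 < w → 0 < G w := fun w hw => by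
    have := hf.pos _ (radius_mem_Ioo hf hβ hw)
    have := Real.sqrt_pos.2 hw
    positivity
  have hGc : ContinuousOn G (Set.Ioi 0) := fun w hw => by
    have hw : 0 < w := hw
    have h1 := hf.pos _ (radius_mem_Ioo hf hβ hw)
    have h2 := Real.sqrt_pos.2 hw
    have h3 : ContinuousAt (fun w => f (radius rN K β w)) w :=
      hf.smooth.continuous.continuousAt.comp (hasDerivAt_radius hf hβ hw).continuousAt
    exact (continuousAt_const.mul (continuousAt_const.div
      (h3.mul Real.continuous_sqrt.continuousAt) (mul_pos h1 h2).ne')).continuousWithinAt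
  have hgc : Continuous g := hGc.comp_continuous (hwc.max continuous_const)
    fun φ => lt_max_of_lt_right (half_pos hw₁)
  let I : Set ℝ := Set.Icc (w₁ / 2) (max ((γ + R) / (β ^ 2 * J ^ 2)) (w₁ / 2))
  have hI0 : I ⊆ Set.Ioi 0 := fun w hw => (half_pos hw₁).trans_le hw.1
  have hIne : I.Nonempty := ⟨w₁ / 2, le_rfl, le_max_right _ _⟩
  have hmemI : ∀ φ, max (conic β γ J R φ) (w₁ / 2) ∈ I := fun φ => by
    refine ⟨le_max_right _ _, max_le_max ?_ le_rfl⟩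
    unfold conic
    gcongr
    exact mul_le_of_le_one_right hR0.le (Real.cos_le_one φ)
  obtain ⟨wm, hwm, hmin⟩ := isCompact_Icc.exists_isMinOn hIne (hGc.mono hI0)
  obtain ⟨wM, hwM, hmax⟩ := isCompact_Icc.exists_isMaxOn hIne (hGc.mono hI0)
  obtain ⟨φ, hφm, hφ0, hφd, S, hS, hφS⟩ := exists_scalar_solution hgc (hGpos wm (hI0 hwm))
    (fun x => hmin (hmemI x)) (fun x => hmax (hmemI x)) (by linarith [hφ₁.1] : -φ₁ < φ₁)
  have hφc : Continuous φ := continuous_iff_continuousAt.2 fun t => (hφd t).continuousAt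
  have hle : ∀ s ∈ Set.Icc 0 S, w₁ ≤ conic β γ J R (φ s) := fun s hs => by
    have h1 : -φ₁ ≤ φ s := hφ0 ▸ hφm.monotone hs.1
    have h2 : φ s ≤ φ₁ := hφS ▸ hφm.monotone hs.2
    have h3 : Real.cos φ₁ ≤ Real.cos (φ s) := by
      rw [← Real.cos_abs (φ s)]
      exact Real.cos_le_cos_of_nonneg_of_le_pi (abs_nonneg _) hφ₁.2.le (abs_le.2 ⟨h1, h2⟩)
    rw [hw₁def]
    unfold conic
    gcongr
  have hO : IsOpen {t | w₁ / 2 < conic β γ J R (φ t)} :=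
    isOpen_lt continuous_const (hwc.comp hφc)
  have hsub : Set.Icc 0 S ⊆ {t | w₁ / 2 < conic β γ J R (φ t)} := fun s hs =>
    (half_lt_self hw₁).trans_le (hle s hs)
  obtain ⟨ε, hε, hεO⟩ := isCompact_Icc.exists_thickening_subset_open hO hsub
  have hlarge : ∀ t ∈ Set.Ioo (-ε) (S + ε), w₁ / 2 < conic β γ J R (φ t) := fun t ht => by
    refine hεO (Metric.mem_thickening_iff.2 ?_)
    rcases le_total t 0 with h1 | h1
    · exact ⟨0, ⟨le_rfl, hS.le⟩, by rw [Real.dist_eq, abs_lt]; constructor <;> linarith [ht.1]⟩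
    rcases le_total t S with h2 | h2
    · exact ⟨t, ⟨h1, h2⟩, by simpa using hε⟩
    · exact ⟨S, ⟨hS.le, le_rfl⟩, by rw [Real.dist_eq, abs_lt]; constructor <;> linarith [ht.2]⟩
  have hsol : Conley.IsSolutionOn (energyManifold f β rN rS γ h) (field f β γ) (-ε) (S + ε)
      (fun t => orbit f rN K β γ J R σ φ₁ z₀ (φ t)) := fun t ht => by
    have h1 := hlarge t ht
    have h2 : 0 < conic β γ J R (φ t) := (half_pos hw₁).trans h1
    refine ⟨orbit_mem hf hβ hJ hR hσ hz₀ h2, hasDerivAt_orbit hf hβ hJ hσ h2 ?_⟩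
    have h3 := hφd t
    simp only [g, max_eq_left h1.le] at h3
    exact h3
  have m0 : (0 : ℝ) ∈ Set.Ioo (-ε) (S + ε) := ⟨by linarith, by linarith⟩
  have mS : S ∈ Set.Ioo (-ε) (S + ε) := ⟨by linarith, by linarith⟩
  have hfl := hsol.flowsTo m0 mS
  rw [sub_zero] at hfl
  refine ⟨_, _, congrArg (orbit f rN K β γ J R σ φ₁ z₀) hφ0,
    congrArg (orbit f rN K β γ J R σ φ₁ z₀) hφS, S, hS, hfl, fun s hs z hz => ?_⟩
  have := (isRegularFlow hf hβ).flowsTo_eq hsol m0 (t := s)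
    ⟨by linarith [hs.1], by linarith [hs.2]⟩ rfl (by simpa using hz)
  rw [← this, ← hr₁]
  exact radius_le_of_le hf hb hw₁ (hle s hs)

/-- Orbits with small angular momentum which come in along a radial orbit go out near the radial orbit
whose angle is greater by `±2π/|β|`. Indeed such an orbit is nearly parabolic, and runs through almost
a full turn of the phase, while the angle is the phase divided by `|β|`. -/
theorem exists_passage (hf : IsSphericalRadius f rN rS K)
    (hβ : ∀ r ∈ Set.Icc rN rS, -f r * deriv (deriv f) r + deriv f r ^ 2 = β ^ 2) (hγ : 0 < γ)
    (hr₁ : r₁ ∈ Set.Ioo rN rS) (hd : 0 < deriv f r₁) {ρ : ℝ}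
    (hρ : ρ = 2 * γ + 2 * h * β ^ 2 * (f r₁ / deriv f r₁)) (hρ0 : 0 < ρ)
    (hσ : σ ^ 2 = 1) (hz₀ : ‖z₀‖ = 1) {δ : ℝ} (hδ : 0 < δ) :
    ∃ x y : energyManifold f β rN rS γ h,
      dist (x : Phase) (r₁, -√ρ, z₀, 0) < δ ∧
      dist (y : Phase) (r₁, √ρ,
        z₀ * Complex.exp ((σ * (Real.pi + Real.pi) / |β| : ℝ) * Complex.I), 0) < δ ∧ ∃ S > 0,
      Conley.FlowsTo (energyManifold f β rN rS γ h) (field f β γ) x S y ∧ ∀ s ∈ Set.Icc 0 S, ∀ z,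
        Conley.FlowsTo (energyManifold f β rN rS γ h) (field f β γ) x s z → (z : Phase).1 ≤ r₁ := by
  have hb : β ≠ 0 := hf.beta_ne_zero hβ
  have hb1 : 0 < |β| := abs_pos.2 hb
  have hfr := hf.pos _ hr₁
  set w₁ := deriv f r₁ / (β ^ 2 * f r₁) with hw₁
  have hw₁0 : 0 < w₁ := by positivity
  have hrad : radius rN K β w₁ = r₁ := radius_eq hf hβ hr₁ hd
  have hρ' : ρ * w₁ = 2 * γ * w₁ + 2 * h := by
    rw [hρ, hw₁]; field_simp
  -- the amplitude, the final phase and the velocity `u` at the ends, as functions of `J`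
  let R : ℝ → ℝ := fun J => √(γ ^ 2 + 2 * h * β ^ 2 * J ^ 2 - J ^ 4 * K)
  let Φ : ℝ → ℝ := fun J => Real.arccos ((β ^ 2 * J ^ 2 * w₁ - γ) / R J)
  let U : ℝ → ℝ := fun J => J / (f r₁ * √w₁)
  have hRc : Continuous R := Real.continuous_sqrt.comp (by fun_prop)
  have hR00 : R 0 = γ := by simp [R, Real.sqrt_sq hγ.le]
  have hΦc : ContinuousAt Φ 0 := Real.continuous_arccos.continuousAt.comp
    (ContinuousAt.div (by fun_prop) hRc.continuousAt (by rw [hR00]; exact hγ.ne'))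
  have hΦ0 : Φ 0 = Real.pi := by
    simp only [Φ, hR00]
    rw [show (β ^ 2 * 0 ^ 2 * w₁ - γ) / γ = -1 by field_simp; ring, Real.arccos_neg_one]
  have hUc : Continuous U := continuous_id.div_const _
  have hU0 : U 0 = 0 := by simp [U]
  let X : ℝ → Phase := fun J => (r₁, -√(ρ - U J ^ 2), z₀, σ * U J)
  let Y : ℝ → Phase := fun J => (r₁, √(ρ - U J ^ 2),
    z₀ * Complex.exp ((σ * (Φ J + Φ J) / |β| : ℝ) * Complex.I), σ * U J)
  have hsq : ContinuousAt (fun J => √(ρ - U J ^ 2)) 0 :=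
    (Real.continuous_sqrt.comp (continuous_const.sub (hUc.pow 2))).continuousAt
  have hXc : ContinuousAt X 0 := continuousAt_const.prodMk
    (hsq.neg.prodMk (continuousAt_const.prodMk (continuousAt_const.mul hUc.continuousAt)))
  have hθc : ContinuousAt (fun J => σ * (Φ J + Φ J) / |β|) 0 :=
    (continuousAt_const.mul (hΦc.add hΦc)).div_const _
  have hYc : ContinuousAt Y 0 := continuousAt_const.prodMk
    (hsq.prodMk ((continuousAt_const.mul (Complex.continuous_exp.continuousAt.comp
      ((Complex.continuous_ofReal.continuousAt.comp hθc).mul continuousAt_const))).prodMk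
      (continuousAt_const.mul hUc.continuousAt)))
  have hX0 : X 0 = (r₁, -√ρ, z₀, 0) := by simp [X, hU0]
  have hY0 : Y 0 = (r₁, √ρ,
      z₀ * Complex.exp ((σ * (Real.pi + Real.pi) / |β| : ℝ) * Complex.I), 0) := by
    simp [Y, hU0, hΦ0]
  have ev1 : ∀ᶠ J in 𝓝[>] (0 : ℝ), dist (X J) (X 0) < δ :=
    (hXc.eventually (Metric.ball_mem_nhds _ hδ)).filter_mono nhdsWithin_le_nhds
  have ev2 : ∀ᶠ J in 𝓝[>] (0 : ℝ), dist (Y J) (Y 0) < δ :=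
    (hYc.eventually (Metric.ball_mem_nhds _ hδ)).filter_mono nhdsWithin_le_nhds
  have ev3 : ∀ᶠ J in 𝓝[>] (0 : ℝ), 0 < γ ^ 2 + 2 * h * β ^ 2 * J ^ 2 - J ^ 4 * K := by
    have hc : ContinuousAt (fun J => γ ^ 2 + 2 * h * β ^ 2 * J ^ 2 - J ^ 4 * K) 0 := by fun_prop
    exact (hc.eventually (lt_mem_nhds (by simp; positivity))).filter_mono nhdsWithin_le_nhds
  have ev4 : ∀ᶠ J in 𝓝[>] (0 : ℝ), 0 < β ^ 2 * (ρ * w₁) - J ^ 2 * (K + β ^ 4 * w₁ ^ 2) := by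
    have hc : ContinuousAt (fun J => β ^ 2 * (ρ * w₁) - J ^ 2 * (K + β ^ 4 * w₁ ^ 2)) 0 := by
      fun_prop
    exact (hc.eventually (lt_mem_nhds (by simp; positivity))).filter_mono nhdsWithin_le_nhds
  obtain ⟨J, hXJ, hYJ, h3, h4, hJ⟩ :=
    (ev1.and (ev2.and (ev3.and (ev4.and self_mem_nhdsWithin)))).exists
  have hJ : 0 < J := hJ
  have hR0 : 0 < R J := Real.sqrt_pos.2 h3
  have hR2 : R J ^ 2 = γ ^ 2 + 2 * h * β ^ 2 * J ^ 2 - J ^ 4 * K := Real.sq_sqrt h3.le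
  -- `r = r₁` is crossed with `v ≠ 0`, so the cosine of the final phase is strictly between `-1` and `1`
  have habs : |β ^ 2 * J ^ 2 * w₁ - γ| < R J := by
    refine abs_lt_of_sq_lt_sq ?_ hR0.le
    have h5 := mul_pos (pow_pos hJ 2) h4
    have h6 : R J ^ 2 - (β ^ 2 * J ^ 2 * w₁ - γ) ^ 2 =
        J ^ 2 * (β ^ 2 * (ρ * w₁) - J ^ 2 * (K + β ^ 4 * w₁ ^ 2)) := by
      rw [hR2, hρ']; ring
    linarith
  obtain ⟨hl, hu⟩ := abs_lt.1 habs
  have hq1 : -1 < (β ^ 2 * J ^ 2 * w₁ - γ) / R J := by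
    rw [lt_div_iff₀ hR0]; linarith
  have hq2 : (β ^ 2 * J ^ 2 * w₁ - γ) / R J < 1 := by
    rw [div_lt_iff₀ hR0]; linarith
  have hcos : Real.cos (Φ J) = (β ^ 2 * J ^ 2 * w₁ - γ) / R J :=
    Real.cos_arccos hq1.le hq2.le
  have hΦI : Φ J ∈ Set.Ioo 0 Real.pi := by
    refine ⟨Real.arccos_pos.2 hq2, lt_of_le_of_ne (Real.arccos_le_pi _) fun he => ?_⟩
    have h5 := hcos
    rw [show Φ J = Real.pi from he, Real.cos_pi] at h5
    linarith
  have hcon : conic β γ J (R J) (Φ J) = w₁ := by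
    unfold conic
    rw [hcos]
    field_simp
    ring
  have hcon' : conic β γ J (R J) (-Φ J) = w₁ := by rw [← hcon]; simp [conic]
  have hsin := Real.sin_pos_of_pos_of_lt_pi hΦI.1 hΦI.2
  set V := R J * Real.sin (Φ J) / (|β| * J * √w₁) with hV
  have hV0 : 0 < V := by
    have := Real.sqrt_pos.2 hw₁0
    positivity
  obtain ⟨x, y, hx, hy, S, hS, hfl, hin⟩ := exists_flowsTo_orbit (r₁ := r₁) (σ := σ) (z₀ := z₀)
    hf hβ hJ hR0 hR2 hσ hz₀ hΦI (hcon ▸ hw₁0) (by rw [hcon, hrad])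
  have hy' : (y : Phase) = (r₁, V,
      z₀ * Complex.exp ((σ * (Φ J + Φ J) / |β| : ℝ) * Complex.I), σ * U J) := by
    rw [hy]; simp only [orbit, hcon, hrad, U, V]
  have hx' : (x : Phase) = (r₁, -V, z₀, σ * U J) := by
    rw [hx]
    simp only [orbit, hcon', hrad, U, V, Real.sin_neg, neg_add_cancel]
    simp [neg_div]
  have hen : U J ^ 2 + V ^ 2 = ρ := by
    have hyM := y.2
    rw [hy', mem_energyManifold_iff (Set.Ioo_subset_Icc_self hr₁) hd] at hyM
    have h5 := hyM.2
    simp only at h5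
    rw [mul_pow, hσ, one_mul] at h5
    rw [hρ]
    exact h5
  have hVs : √(ρ - U J ^ 2) = V := by
    rw [show ρ - U J ^ 2 = V ^ 2 by linarith, Real.sqrt_sq hV0.le]
  refine ⟨x, y, ?_, ?_, S, hS, hfl, hin⟩
  · rw [← hX0, hx', ← hVs]
    exact hXJ
  · rw [← hY0, hy', ← hVs]
    exact hYJ

end
end Kepler

namespace Kepler

/-! ### Trivializable blocks -/

section
variable {f : ℝ → ℝ} {rN rS K β γ h : ℝ}

/-- Every neighbourhood of the collision manifold contains all points with `r ≤ r₁`, for a suitable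
`r₁ > rN`. -/
theorem exists_collar (hf : IsSphericalRadius f rN rS K)
    (hβ : ∀ r ∈ Set.Icc rN rS, -f r * deriv (deriv f) r + deriv f r ^ 2 = β ^ 2) (hγ : 0 < γ)
    {U : Set (energyManifold f β rN rS γ h)} (hU : IsOpen U)
    (hNU : collisionManifold f β rN rS γ h ⊆ U) :
    ∃ r₁ ∈ Set.Ioo rN rS, (∀ r ∈ Set.Icc rN r₁, 0 < deriv f r) ∧
      (∀ r ∈ Set.Icc rN r₁, 0 < 2 * γ + 2 * h * β ^ 2 * (f r / deriv f r)) ∧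
      ∀ x : energyManifold f β rN rS γ h, (x : Phase).1 ≤ r₁ → x ∈ U := by
  have hd0 : 0 < deriv f rN := by
    rw [hf.deriv_north hβ]; exact abs_pos.2 (hf.beta_ne_zero hβ)
  have hfc := hf.smooth.continuous
  have hdc := hf.contDiff_deriv.continuous
  have hc : ContinuousAt (fun r => 2 * γ + 2 * h * β ^ 2 * (f r / deriv f r)) rN :=
    continuousAt_const.add (continuousAt_const.mul (hfc.continuousAt.div hdc.continuousAt hd0.ne'))
  obtain ⟨η, hη, hball⟩ := Metric.eventually_nhds_iff.1
    ((hdc.continuousAt.eventually (lt_mem_nhds hd0)).and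
      (hc.eventually (lt_mem_nhds (a := 0) (by simp [hf.north, hγ]))))
  obtain ⟨r', hr'N, hr'⟩ := exists_between (lt_min (by linarith : rN < rN + η) hf.lt)
  rw [lt_min_iff] at hr'
  have hP : ∀ r ∈ Set.Icc rN r', 0 < deriv f r ∧
      0 < 2 * γ + 2 * h * β ^ 2 * (f r / deriv f r) := fun r hr =>
    hball (by rw [Real.dist_eq, abs_lt]; constructor <;> linarith [hr.1, hr.2])
  have hmem : ∀ x : Phase, x.1 ∈ Set.Icc rN r' → (x ∈ energyManifold f β rN rS γ h ↔
      ‖x.2.2.1‖ = 1 ∧ x.2.2.2 ^ 2 + x.2.1 ^ 2 = 2 * γ + 2 * h * β ^ 2 * (f x.1 / deriv f x.1)) :=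
    fun x hx => mem_energyManifold_iff ⟨hx.1, hx.2.trans hr'.2.le⟩ (hP _ hx).1
  let A : Set Phase := {x | x ∈ energyManifold f β rN rS γ h ∧ x.1 ≤ r'}
  have hAI : ∀ x ∈ A, x.1 ∈ Set.Icc rN r' := fun x hx => ⟨hx.1.1.1, hx.2⟩
  have hAclosed : IsClosed A := by
    have hA : A = {x | x.1 ∈ Set.Icc rN r'} ∩ ({x | ‖x.2.2.1‖ = 1} ∩
        {x | (x.2.2.2 ^ 2 + x.2.1 ^ 2 - 2 * γ) * deriv f x.1 = 2 * h * β ^ 2 * f x.1}) := by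
      ext x
      by_cases hx : x.1 ∈ Set.Icc rN r'
      · have hd := (hP _ hx).1
        have e : A x ↔ x ∈ energyManifold f β rN rS γ h := ⟨fun h => h.1, fun h => ⟨h, hx.2⟩⟩
        refine (e.trans (hmem x hx)).trans ?_
        simp only [Set.mem_inter_iff, Set.mem_ofPred_eq, hx, true_and]
        refine and_congr_right fun _ => ?_
        rw [← eq_div_iff hd.ne', mul_div_assoc]
        constructor <;> intro h' <;> linarith
      · exact iff_of_false (fun h => hx (hAI x h)) (fun h => hx h.1)
    rw [hA]
    refine (isClosed_Icc.preimage continuous_fst).inter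
      ((isClosed_eq (by fun_prop) continuous_const).inter (isClosed_eq ?_ ?_))
    · exact Continuous.mul (by fun_prop) (hdc.comp continuous_fst)
    · exact continuous_const.mul (hfc.comp continuous_fst)
  obtain ⟨C, hC⟩ := isCompact_Icc.exists_bound_of_continuousOn (s := Set.Icc rN r')
    (f := fun r => 2 * γ + 2 * h * β ^ 2 * (f r / deriv f r)) (fun r hr =>
      (continuousAt_const.add (continuousAt_const.mul (hfc.continuousAt.div hdc.continuousAt
        (hP r hr).1.ne'))).continuousWithinAt)
  have hAcomp : IsCompact A := by
    refine (isCompact_Icc.prod (isCompact_Icc.prod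
      ((isCompact_closedBall (0 : ℂ) 1).prod isCompact_Icc))).of_isClosed_subset
      (s := Set.Icc rN r' ×ˢ Set.Icc (-(C + 1)) (C + 1) ×ˢ Metric.closedBall (0 : ℂ) 1 ×ˢ
        Set.Icc (-(C + 1)) (C + 1)) hAclosed fun x hx => ?_
    have hxI := hAI x hx
    obtain ⟨h1, h2⟩ := (hmem x hxI).1 hx.1
    have h3 := (le_abs_self _).trans (hC _ hxI)
    refine ⟨hxI, abs_le.1 (abs_le_of_sq_le_sq ?_ ?_), by simp [h1],
      abs_le.1 (abs_le_of_sq_le_sq ?_ ?_)⟩ <;> nlinarith [sq_nonneg x.2.1, sq_nonneg x.2.2.2]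
  obtain ⟨V, hV, hVU⟩ := isOpen_induced_iff.1 hU
  have hVU' : ∀ x : energyManifold f β rN rS γ h, (x : Phase) ∈ V ↔ x ∈ U := fun x => by
    rw [← hVU]; rfl
  rcases (A \ V).eq_empty_or_nonempty with hempty | hne
  · refine ⟨r', ⟨hr'N, hr'.2⟩, fun r hr => (hP r hr).1, fun r hr => (hP r hr).2, fun x hx => ?_⟩
    rw [← hVU']
    by_contra hcon
    exact (hempty ▸ (⟨⟨x.2, hx⟩, hcon⟩ : (x : Phase) ∈ A \ V) : (x : Phase) ∈ (∅ : Set Phase))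
  · obtain ⟨x₀, hx₀, hmin⟩ := (hAcomp.diff hV).exists_isMinOn hne continuous_fst.continuousOn
    have hlt : rN < x₀.1 := lt_of_le_of_ne (hAI x₀ hx₀.1).1 fun he =>
      hx₀.2 ((hVU' ⟨x₀, hx₀.1.1⟩).2 (hNU he.symm))
    have hle : ∀ r ∈ Set.Icc rN ((rN + x₀.1) / 2), r ∈ Set.Icc rN r' := fun r hr =>
      ⟨hr.1, by linarith [hr.2, hx₀.1.2]⟩
    refine ⟨(rN + x₀.1) / 2, ⟨by linarith, by linarith [hx₀.1.2, hr'.2]⟩,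
      fun r hr => (hP r (hle r hr)).1, fun r hr => (hP r (hle r hr)).2, fun x hx => ?_⟩
    rw [← hVU']
    by_contra hcon
    have := hmin (⟨⟨x.2, by linarith [hx₀.1.2]⟩, hcon⟩ : (x : Phase) ∈ A \ V)
    simp only [Set.mem_ofPred_eq] at this
    linarith

/-- If the collision manifold is trivializable, then the two sides `σ = ±1` from which orbits of small
angular momentum pass by give the same angle of exit. -/
theorem exp_eq_exp_of_isTrivializable (hf : IsSphericalRadius f rN rS K)
    (hβ : ∀ r ∈ Set.Icc rN rS, -f r * deriv (deriv f) r + deriv f r ^ 2 = β ^ 2) (hγ : 0 < γ)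
    (hN : Conley.IsTrivializableIsolatedInvariantSet (energyManifold f β rN rS γ h)
      (field f β γ) 2 (collisionManifold f β rN rS γ h)) :
    Complex.exp (((1 : ℝ) * (Real.pi + Real.pi) / |β| : ℝ) * Complex.I) =
      Complex.exp (((-1 : ℝ) * (Real.pi + Real.pi) / |β| : ℝ) * Complex.I) := by
  obtain ⟨-, B, hB, ⟨hUo, hNB, hiso⟩, φ, ⟨hφ, -, hext⟩, -⟩ := hN
  have hreg := isRegularFlow (γ := γ) (h := h) hf hβ
  obtain ⟨r₁, hr₁, hd, hρ, hin⟩ := exists_collar hf hβ hγ hUo hNB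
  have hd₁ := hd r₁ ⟨hr₁.1.le, le_rfl⟩
  obtain ⟨ρ, hρe⟩ : ∃ ρ, ρ = 2 * γ + 2 * h * β ^ 2 * (f r₁ / deriv f r₁) := ⟨_, rfl⟩
  have hρ0 : 0 < ρ := hρe ▸ hρ r₁ ⟨hr₁.1.le, le_rfl⟩
  have hs : 0 < √ρ := Real.sqrt_pos.2 hρ0
  have hs2 : √ρ ^ 2 = ρ := Real.sq_sqrt hρ0.le
  have hmem : ∀ (v : ℝ) (z : ℂ), v ^ 2 = ρ → ‖z‖ = 1 →
      ((r₁, v, z, 0) : Phase) ∈ energyManifold f β rN rS γ h := fun v z hv hz => by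
    rw [mem_energyManifold_iff (Set.Ioo_subset_Icc_self hr₁) hd₁]
    exact ⟨hz, by simp [hv, hρe]⟩
  have hnorth : ∀ (v : ℝ) (z : ℂ), ((r₁, v, z, 0) : Phase) ∈ northern f rN rS := fun v z =>
    ⟨hr₁.1, hr₁.2, hd₁⟩
  -- a solution through a point of `r = r₁` which leaves the interior of the block
  have hleave : ∀ x : energyManifold f β rN rS γ h, (x : Phase).1 = r₁ → ∃ a b c t,
      (0 : ℝ) ∈ Set.Ioo a b ∧ t ∈ Set.Ioo a b ∧
      Conley.IsSolutionOn (energyManifold f β rN rS γ h) (field f β γ) a b c ∧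
      c 0 = x ∧ c t ∉ Subtype.val '' interior B := by
    intro x hx
    have hxN : x ∉ collisionManifold f β rN rS γ h := fun h' => by
      have h' : (x : Phase).1 = rN := h'
      exact hr₁.1.ne (h'.symm.trans hx)
    have := mt (hiso x) hxN
    push Not at this
    obtain ⟨t, y, ⟨a, b, c, h0, ht, hc, hc0, hct⟩, hy⟩ := this
    refine ⟨a, b, c, t, h0, ht, hc, hc0, ?_⟩
    rintro ⟨w, hw, hw'⟩
    exact hy ((Subtype.ext (hw'.trans hct) : w = y) ▸ hw)
  have hinB : ∀ x : Phase, x ∈ energyManifold f β rN rS γ h → x.1 ≤ r₁ →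
      x ∈ Subtype.val '' interior B := fun x hx hxr => ⟨⟨x, hx⟩, hin ⟨x, hx⟩ hxr, rfl⟩
  -- the entry point of the radial orbit that comes in at the angle `0`
  have hx₀ := hmem (-√ρ) 1 (by rw [neg_sq, hs2]) norm_one
  obtain ⟨a, b, c, t, h0, ht, hc, hc0, hct⟩ := hleave ⟨_, hx₀⟩ rfl
  have ht0 : t < 0 := by
    by_contra! hcon
    refine hct (hinB _ (hc t ht).1 ?_)
    exact le_of_radial_incoming hf hβ hρ hc h0 (hc0 ▸ hnorth _ _) (by rw [hc0])
      (by rw [hc0]) (by rw [hc0]; simpa using hs) t ⟨hcon, ht.2⟩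
  obtain ⟨p, hp, hentry⟩ := hB.exists_entry_near hreg hc h0 (hc0 ▸ hnorth _ _)
    (hinB _ (hc 0 h0).1 (by rw [hc0])) ⟨ht.1, ht0⟩ hct
  rw [hc0] at hentry
  -- on either side, its image lies on the radial orbit that goes out at the corresponding angle
  have key : ∀ σ : ℝ, σ ^ 2 = 1 → ((φ ⟨p, hp⟩ : energyManifold f β rN rS γ h) : Phase).2.2.1 =
      Complex.exp ((σ * (Real.pi + Real.pi) / |β| : ℝ) * Complex.I) := by
    intro σ hσ
    have hy := hmem √ρ (Complex.exp ((σ * (Real.pi + Real.pi) / |β| : ℝ) * Complex.I)) hs2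
      (Complex.norm_exp_ofReal_mul_I _)
    obtain ⟨a', b', d, t', h0', ht', hd', hd0, hdt⟩ := hleave ⟨_, hy⟩ rfl
    have hdW : d 0 ∈ northern f rN rS := hd0 ▸ hnorth _ _
    have hdu : (d 0).2.2.2 = 0 := by rw [hd0]
    have ht0' : 0 < t' := by
      by_contra! hcon
      refine hdt (hinB _ (hd' t' ht').1 ?_)
      exact le_of_radial_outgoing hf hβ hρ hd' h0' hdW hdu (by rw [hd0])
        (by rw [hd0]; exact hs) t' ⟨ht'.1, hcon⟩
    obtain ⟨t₂, ht₂, ht₂B⟩ := hB.exists_exit hreg hd' h0' hdW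
      (hinB _ (hd' 0 h0').1 (by rw [hd0])) ⟨ht0', ht'.2⟩ hdt
    obtain ⟨s, hs', he⟩ := hreg.exists_extension_eq hB.isCompact hφ hext ⟨p, hp⟩ hentry hd' h0'
      hdW ht₂ ht₂B fun δ hδ => by
        obtain ⟨x, y, hx, hy, S, hS, hfl, hle⟩ :=
          exists_passage hf hβ hγ hr₁ hd₁ hρe hρ0 hσ norm_one hδ (z₀ := 1)
        rw [one_mul] at hy
        exact ⟨x, y, hx, by rw [hd0]; exact hy, S, hS, hfl,
          fun s hs z hz => hin z (hle s hs z hz)⟩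
    rw [he, (radial_of_solution hf hβ hd' h0' hdW hdu s
      ⟨h0'.1.trans_le hs'.1, hs'.2.trans_lt ht₂.2⟩).2, hd0]
  exact (key 1 (by norm_num)).symm.trans (key (-1) (by norm_num))

end
end Kepler

theorem theorem3 (f : ℝ → ℝ) (rN rS K β γ h : ℝ)
    (hf : Kepler.IsSphericalRadius f rN rS K)
    (hβ : ∀ r ∈ Set.Icc rN rS, -f r * deriv (deriv f) r + deriv f r ^ 2 = β ^ 2)
    (hγ : 0 < γ)
    (hN : Conley.IsTrivializableIsolatedInvariantSet
      (Kepler.energyManifold f β rN rS γ h) (Kepler.field f β γ) 2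
      (Kepler.collisionManifold f β rN rS γ h)) :
    ∃ m : ℕ, 0 < m ∧ |β| = 2 / (m : ℝ) := by
  have hb : 0 < |β| := abs_pos.2 (hf.beta_ne_zero hβ)
  obtain ⟨n, hn⟩ := Complex.exp_eq_exp_iff_exists_int.1
    (Kepler.exp_eq_exp_of_isTrivializable hf hβ hγ hN)
  have him := congrArg Complex.im hn
  simp only [Complex.add_im, Complex.mul_im, Complex.ofReal_re, Complex.ofReal_im, Complex.I_re,
    Complex.I_im, Complex.intCast_re, Complex.intCast_im, Complex.mul_re, Complex.re_ofNat,
    Complex.im_ofNat] at him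
  have hn2 : (n : ℝ) * |β| = 2 := by
    have hπ := Real.pi_pos.ne'
    field_simp at him
    exact mul_left_cancel₀ hπ (by linarith)
  have hn0 : 0 < n := by
    have : (0 : ℝ) < n := by
      by_contra! hcon
      linarith [mul_nonpos_of_nonpos_of_nonneg hcon hb.le]
    exact_mod_cast this
  lift n to ℕ using hn0.le
  refine ⟨n, by exact_mod_cast hn0, ?_⟩
  rw [eq_div_iff (by exact_mod_cast hn0.ne'), mul_comm]
  exact_mod_cast hn2
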